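/- **Proposition (\(M_r\circ W_r\) is the identity).** Let \(n\ge 0\) be an integer and let \(h>0\), \(c>0\), \(\kappa>0\) be real constants. *Group and representation.* Let \(\mathbb H^n=\{(s,x,y): s\in\mathbb R,\ x,y\in\mathbb R^n\}\) be the Heisenberg group with the law \[(s,x,y)*(s',x',y')=\bigl(s+s'+\tfrac12(x\cdot y'-x'\cdot y),\,x+x',\,y+y'\bigr)\] and Haar measure \(dg=ds\,dx\,dy\). Let \(F_2\subset L^2(\mathbb R^{2n},dq\,dp)\) be the closed subspace of those \(f\) that satisfy, in the sense of distributions, \[\tfrac h2\bigl(\partial_{p_j}+ c\,i\,\partial_{q_j}\bigr)f+2\pi(c\,p_j+i q_j)f=0,\qquad 1\le j\le n,\] with the inner product \(\langle f_1,f_2\rangle=(4/h)^n\int_{\mathbb R^{2n}} f_1\overline{f_2}\,dq\,dp\). The group acts on \(F_2\) by the unitary representation \[[\rho_h(s,x,y)f](q,p)=e^{-2\pi i(hs+q\cdot x+p\cdot y)}f\bigl(q-\tfrac h2y,\;p+\tfrac h2x\bigr),\] which extends to kernels \(k\in L^1(\mathbb H^n)\) by \(\rho_h(k)f=\kappa^{n+1}\int_{\mathbb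 H^n}k(g)\,\rho_h(g)f\,dg\) for \(f\in F_2\). Let \(v_0(q,p)=\exp\bigl(-\tfrac{2\pi}{h}(c^{-1}|q|^2+c|p|^2)\bigr)\) be the vacuum vector and \(v_{(x,y)}=\rho_h(0,x,y)v_0\) the coherent states. *Transforms.* For a bounded operator \(B\) on \(F_2\) put \[\operatorname{tr}B=h^n\int_{\mathbb R^{2n}}\langle Bv_{(x',y')},v_{(x',y')}\rangle\,dx'\,dy',\] which is said to exist if the integral converges absolutely. The reduced wavelet transform of a bounded operator \(A\) on \(F_2\) is \[(W_rA)(x,y)=\operatorname{tr}\bigl(\rho_h((0,x,y)^{-1})A\bigr),\] and the inverse transform of \(a\in L^1(\mathbb R^{2n})\) is the bounded operator \(M_ra\) on \(F_2\) given by \[(M_ra)f=h^n\int_{\mathbb R^{2n}}a(x,y)\,\rho_h(0,x,y)f\,dx\,dy,\qquad f\in F_2 .\] *Claim.* 1. Let \(k\in L^1(\mathbb H^n)\) be a kernel such that the trace \((W_r\rho_h(k))(x,y)\) exists for almost every \((x,y)\in\mathbb R^{2n}\). Then \(W_r\rho_h(k)\in L^1(\mathbb R^{2n})\) and \[M_r\bigl(W_r\,\rho_h(k)\bigr)=\rho_h(k).\]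 2. For every Schwartz function \(k\) on \(\mathbb H^n\) (in the coordinates \((s,x,y)\)) one has \(k\in L^1(\mathbb H^n)\), and \((W_r\rho_h(k))(x,y)\) exists for every \((x,y)\in\mathbb R^{2n}\); so the first part applies to \(k\). -/

import Mathlib

open MeasureTheory Complex
open scoped InnerProductSpace ContDiff

noncomputable section

/-- The configuration space `ℝⁿ`. -/
abbrev RSpace (n : ℕ) : Type := EuclideanSpace ℝ (Fin n)

/-- The space `ℝ²ⁿ`; its points are written `(q, p)` when it is the coadjoint orbit of a
nonzero Planck constant, and `(x, y)` when it is the group modulo its centre. -/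
abbrev Phase (n : ℕ) : Type := RSpace n × RSpace n

instance (n : ℕ) : (volume : Measure (Phase n)).IsAddHaarMeasure :=
  Measure.prod.instIsAddHaarMeasure _ _

/-- The Heisenberg group `ℍⁿ` in exponential coordinates `(s, x, y)`. -/
@[ext]
structure Heisenberg (n : ℕ) where
  s : ℝ
  x : RSpace n
  y : RSpace n

namespace Heisenberg

variable {n : ℕ}

/-- `(s,x,y) * (s',x',y') = (s + s' + (x·y' - x'·y)/2, x + x', y + y')`. -/
instance : Mul (Heisenberg n) :=
  ⟨fun a b => ⟨a.s + b.s + (1 / 2) * (⟪a.x, b.y⟫_ℝ - ⟪b.x, a.y⟫_ℝ), a.x + b.x, a.y + b.y⟩⟩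

instance : One (Heisenberg n) := ⟨⟨0, 0, 0⟩⟩

instance : Inv (Heisenberg n) := ⟨fun a => ⟨-a.s, -a.x, -a.y⟩⟩

@[simp] theorem mul_s (a b : Heisenberg n) :
    (a * b).s = a.s + b.s + (1 / 2) * (⟪a.x, b.y⟫_ℝ - ⟪b.x, a.y⟫_ℝ) := rfl
@[simp] theorem mul_x (a b : Heisenberg n) : (a * b).x = a.x + b.x := rfl
@[simp] theorem mul_y (a b : Heisenberg n) : (a * b).y = a.y + b.y := rfl
@[simp] theorem one_s : (1 : Heisenberg n).s = 0 := rfl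
@[simp] theorem one_x : (1 : Heisenberg n).x = 0 := rfl
@[simp] theorem one_y : (1 : Heisenberg n).y = 0 := rfl
@[simp] theorem inv_s (a : Heisenberg n) : (a⁻¹).s = -a.s := rfl
@[simp] theorem inv_x (a : Heisenberg n) : (a⁻¹).x = -a.x := rfl
@[simp] theorem inv_y (a : Heisenberg n) : (a⁻¹).y = -a.y := rfl

instance : Group (Heisenberg n) :=
  Group.ofLeftAxioms
    (fun a b c => by
      ext1
      · simp only [mul_s, mul_x, mul_y, inner_add_left, inner_add_right]; ring
      · simp [add_assoc]
      · simp [add_assoc])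
    (fun a => by ext1 <;> simp)
    (fun a => by
      ext1
      · simp
      · simp
      · simp)

/-- Exponential coordinates on the group. -/
def coords : Heisenberg n ≃ ℝ × RSpace n × RSpace n where
  toFun g := (g.s, g.x, g.y)
  invFun v := ⟨v.1, v.2.1, v.2.2⟩
  left_inv _ := rfl
  right_inv _ := rfl

instance : MeasurableSpace (Heisenberg n) := MeasurableSpace.comap coords inferInstance

/-- The Haar measure `dg`: Lebesgue measure in the exponential coordinates. -/
instance : MeasureSpace (Heisenberg n) where
  volume := Measure.map coords.symm volume

theorem measurable_coords : Measurable (coords (n := n)) := comap_measurable _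

/-- The section `(x, y) ↦ (0, x, y)` of the projection of the group modulo its centre. -/
def lift (z : Phase n) : Heisenberg n := ⟨0, z.1, z.2⟩

end Heisenberg

section Representation

variable {n : ℕ}

/-- The real phase of the multiplier `e^{-2πi(hs + qx + py)}`. -/
def repPhase (h : ℝ) (g : Heisenberg n) (w : Phase n) : ℝ :=
  -(2 * Real.pi) * (h * g.s + ⟪w.1, g.x⟫_ℝ + ⟪w.2, g.y⟫_ℝ)

/-- `ρ_h(s,x,y)` on functions:
`f(q,p) ↦ e^{-2πi(hs + qx + py)} f(q - (h/2) y, p + (h/2) x)`. -/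
def repFun (h : ℝ) (g : Heisenberg n) (f : Phase n → ℂ) : Phase n → ℂ := fun w =>
  cexp (repPhase h g w * I) * f (w.1 - (h / 2) • g.y, w.2 + (h / 2) • g.x)

/-- The translation vector of `ρ_h(s,x,y)`. -/
def repShift (h : ℝ) (g : Heisenberg n) : Phase n := (-((h / 2) • g.y), (h / 2) • g.x)

theorem repFun_apply (h : ℝ) (g : Heisenberg n) (f : Phase n → ℂ) (w : Phase n) :
    repFun h g f w = cexp (repPhase h g w * I) * f (w + repShift h g) := by
  simp only [repFun, repShift, sub_eq_add_neg]; rfl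

theorem continuous_repPhase (h : ℝ) (g : Heisenberg n) : Continuous (repPhase h g) := by
  unfold repPhase; fun_prop

theorem measurePreserving_repShift (h : ℝ) (g : Heisenberg n) :
    MeasurePreserving (fun w : Phase n => w + repShift h g) volume volume :=
  measurePreserving_add_right volume (repShift h g)

theorem norm_repFun (h : ℝ) (g : Heisenberg n) (f : Phase n → ℂ) (w : Phase n) :
    ‖repFun h g f w‖ = ‖f (w + repShift h g)‖ := by
  rw [repFun_apply, norm_mul, Complex.norm_exp_ofReal_mul_I, one_mul]

theorem aestronglyMeasurable_repFun (h : ℝ) (g : Heisenberg n) {f : Phase n → ℂ}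
    (hf : AEStronglyMeasurable f volume) : AEStronglyMeasurable (repFun h g f) volume := by
  have h1 : repFun h g f =
      fun w => cexp (repPhase h g w * I) * (f ∘ fun w => w + repShift h g) w := by
    funext w; exact repFun_apply h g f w
  rw [h1]
  refine AEStronglyMeasurable.mul ?_
    (hf.comp_measurePreserving (measurePreserving_repShift h g))
  have := continuous_repPhase h g
  exact Continuous.aestronglyMeasurable (by fun_prop)

theorem eLpNorm_repFun (h : ℝ) (g : Heisenberg n) {f : Phase n → ℂ}
    (hf : AEStronglyMeasurable f volume) :
    eLpNorm (repFun h g f) 2 volume = eLpNorm f 2 volume := by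
  rw [← eLpNorm_comp_measurePreserving hf (measurePreserving_repShift h g)]
  exact eLpNorm_congr_norm_ae (Filter.Eventually.of_forall fun w => norm_repFun h g f w)

theorem memLp_repFun (h : ℝ) (g : Heisenberg n) {f : Phase n → ℂ} (hf : MemLp f 2 volume) :
    MemLp (repFun h g f) 2 volume :=
  ⟨aestronglyMeasurable_repFun h g hf.1, by rw [eLpNorm_repFun h g hf.1]; exact hf.2⟩

theorem repFun_congr (h : ℝ) (g : Heisenberg n) {f f' : Phase n → ℂ} (hf : f =ᵐ[volume] f') :
    repFun h g f =ᵐ[volume] repFun h g f' := by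
  filter_upwards [(measurePreserving_repShift h g).quasiMeasurePreserving.ae hf] with w hw
  rw [repFun_apply, repFun_apply, hw]

/-- `ρ_h(g)` as an isometry of `L²(ℝ²ⁿ)`. -/
def repLp (h : ℝ) (g : Heisenberg n) :
    Lp ℂ 2 (volume : Measure (Phase n)) →ₗᵢ[ℂ] Lp ℂ 2 (volume : Measure (Phase n)) where
  toFun f := (memLp_repFun h g (Lp.memLp f)).toLp (repFun h g f)
  map_add' f f' := by
    rw [← MemLp.toLp_add]
    apply MemLp.toLp_congr
    refine (repFun_congr h g (Lp.coeFn_add f f')).trans (Filter.Eventually.of_forall fun w => ?_)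
    simp [repFun, mul_add]
  map_smul' a f := by
    rw [RingHom.id_apply, ← MemLp.toLp_const_smul]
    apply MemLp.toLp_congr
    refine (repFun_congr h g (Lp.coeFn_smul a f)).trans (Filter.Eventually.of_forall fun w => ?_)
    simp only [repFun, Pi.smul_apply, smul_eq_mul]; ring
  norm_map' f := by
    simp only [LinearMap.coe_mk, AddHom.coe_mk]
    rw [Lp.norm_toLp, eLpNorm_repFun h g (Lp.memLp f).1, Lp.norm_def]

theorem coeFn_repLp (h : ℝ) (g : Heisenberg n) (f : Lp ℂ 2 (volume : Measure (Phase n))) :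
    repLp h g f =ᵐ[volume] repFun h g f :=
  MemLp.coeFn_toLp (memLp_repFun h g (Lp.memLp f))

/-- Strong continuity of `ρ_h`, in exponential coordinates. -/
theorem continuous_repLp (h : ℝ) (f : Lp ℂ 2 (volume : Measure (Phase n))) :
    Continuous fun v : ℝ × RSpace n × RSpace n => repLp h (Heisenberg.coords.symm v) f := by
  let τ : (ℝ × RSpace n × RSpace n) → C(Phase n, Phase n) := fun v =>
    ⟨fun w => w + repShift h (Heisenberg.coords.symm v), by fun_prop⟩
  have hτm : ∀ v, MeasurePreserving (τ v) (volume : Measure (Phase n)) volume :=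
    fun v => measurePreserving_repShift h _
  have hτ : Continuous τ := by
    apply ContinuousMap.continuous_of_continuous_uncurry
    simp only [Function.uncurry_def, τ, repShift, Heisenberg.coords, Equiv.coe_fn_symm_mk,
      ContinuousMap.coe_mk]
    fun_prop
  have hcomp : Continuous fun v => Lp.compMeasurePreserving (τ v) (hτm v) f :=
    Continuous.compMeasurePreservingLp continuous_const hτ hτm (by norm_num)
  rw [continuous_iff_continuousAt]
  intro v₀
  set F : Lp ℂ 2 (volume : Measure (Phase n)) := Lp.compMeasurePreserving (τ v₀) (hτm v₀) f
    with hF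
  let e : (ℝ × RSpace n × RSpace n) → Phase n → ℂ := fun v w =>
    cexp (repPhase h (Heisenberg.coords.symm v) w * I)
  have he : ∀ w, Continuous fun v => e v w := by
    intro w
    simp only [e, repPhase, Heisenberg.coords, Equiv.coe_fn_symm_mk]
    fun_prop
  have hew : ∀ v, Continuous (e v) := by
    intro v
    have := continuous_repPhase h (Heisenberg.coords.symm v)
    simp only [e]; fun_prop
  have hen : ∀ v w, ‖e v w‖ = 1 := fun v w => Complex.norm_exp_ofReal_mul_I _
  have hcoe : ∀ v, repLp h (Heisenberg.coords.symm v) f =ᵐ[volume]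
      fun w => e v w * (Lp.compMeasurePreserving (τ v) (hτm v) f : Phase n → ℂ) w := by
    intro v
    filter_upwards [coeFn_repLp h (Heisenberg.coords.symm v) f,
      Lp.coeFn_compMeasurePreserving f (hτm v)] with w h1 h2
    rw [h1, h2, repFun_apply]; rfl
  have hsq : Integrable (fun w => 4 * ‖F w‖ ^ 2) (volume : Measure (Phase n)) := by
    have := (Lp.memLp F).integrable_norm_pow (p := 2) (by norm_num)
    simpa using this.const_mul 4
  have hlim : Filter.Tendsto (fun v => ∫ w, ‖(e v w - e v₀ w) * F w‖ ^ 2) (nhds v₀)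
      (nhds (∫ w : Phase n, (0 : ℝ))) := by
    refine tendsto_integral_filter_of_dominated_convergence (fun w => 4 * ‖F w‖ ^ 2)
      (Filter.Eventually.of_forall fun v => ?_) (Filter.Eventually.of_forall fun v =>
        Filter.Eventually.of_forall fun w => ?_) hsq (Filter.Eventually.of_forall fun w => ?_)
    · exact ((((hew v).sub (hew v₀)).aestronglyMeasurable.mul (Lp.memLp F).1).norm.pow 2)
    · rw [norm_pow, norm_norm, norm_mul, mul_pow]
      have : ‖e v w - e v₀ w‖ ≤ 2 := by
        refine (norm_sub_le _ _).trans ?_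
        rw [hen, hen]; norm_num
      have h2 : ‖e v w - e v₀ w‖ ^ 2 ≤ 4 := by nlinarith [norm_nonneg (e v w - e v₀ w)]
      exact mul_le_mul_of_nonneg_right h2 (by positivity)
    · have h1 : Filter.Tendsto (fun v => ‖(e v w - e v₀ w) * F w‖ ^ 2) (nhds v₀)
          (nhds (‖(e v₀ w - e v₀ w) * F w‖ ^ 2)) := by
        have := he w
        exact Continuous.tendsto (by fun_prop) v₀
      simpa using h1
  rw [integral_zero] at hlim
  rw [ContinuousAt, tendsto_iff_norm_sub_tendsto_zero]
  have hup : Filter.Tendsto (fun v => ‖Lp.compMeasurePreserving (τ v) (hτm v) f - F‖ +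
      Real.sqrt (∫ w, ‖(e v w - e v₀ w) * F w‖ ^ 2)) (nhds v₀) (nhds 0) := by
    have h1 := tendsto_iff_norm_sub_tendsto_zero.1 (hcomp.tendsto v₀)
    have h2 := (Real.continuous_sqrt.tendsto _).comp hlim
    simpa using h1.add h2
  refine squeeze_zero (fun _ => norm_nonneg _) (fun v => ?_) hup
  have hm1 : MemLp (fun w => e v w * (Lp.compMeasurePreserving (τ v) (hτm v) f - F :
      Lp ℂ 2 (volume : Measure (Phase n))) w) 2 volume :=
    (Lp.memLp (Lp.compMeasurePreserving (τ v) (hτm v) f - F)).of_le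
      ((hew v).aestronglyMeasurable.mul (Lp.memLp _).1)
      (Filter.Eventually.of_forall fun w => by rw [norm_mul, hen, one_mul])
  have hm2 : MemLp (fun w => (e v w - e v₀ w) * F w) 2 volume := by
    refine (Lp.memLp F).of_le_mul (c := 2)
      (((hew v).sub (hew v₀)).aestronglyMeasurable.mul (Lp.memLp _).1)
      (Filter.Eventually.of_forall fun w => ?_)
    rw [norm_mul]
    refine mul_le_mul_of_nonneg_right ?_ (norm_nonneg _)
    refine (norm_sub_le _ _).trans ?_
    rw [hen, hen]; norm_num
  have hsplit : repLp h (Heisenberg.coords.symm v) f - repLp h (Heisenberg.coords.symm v₀) f =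
      hm1.toLp + hm2.toLp := by
    apply Lp.ext
    filter_upwards [Lp.coeFn_sub (repLp h (Heisenberg.coords.symm v) f)
      (repLp h (Heisenberg.coords.symm v₀) f), Lp.coeFn_add hm1.toLp hm2.toLp,
      hm1.coeFn_toLp, hm2.coeFn_toLp, hcoe v, hcoe v₀,
      Lp.coeFn_sub (Lp.compMeasurePreserving (τ v) (hτm v) f) F] with w h1 h2 h3 h4 h5 h6 h7
    rw [h1, h2, Pi.sub_apply, Pi.add_apply, h3, h4, h5, h6, h7, Pi.sub_apply, ← hF]
    ring
  rw [hsplit]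
  refine (norm_add_le _ _).trans (add_le_add (le_of_eq ?_) (le_of_eq ?_))
  · rw [Lp.norm_toLp, Lp.norm_def]
    congr 1
    exact eLpNorm_congr_norm_ae (Filter.Eventually.of_forall fun w => by
      rw [norm_mul, hen, one_mul])
  · rw [Lp.norm_toLp, hm2.eLpNorm_eq_integral_rpow_norm (by norm_num) (by norm_num),
      ENNReal.toReal_ofReal (by positivity), Real.sqrt_eq_rpow]
    norm_num

end Representation

section Fock

variable {n : ℕ}

/-- The formal transpose of `D^j = (h/2)(∂_{p_j} + c i ∂_{q_j}) + 2π(c p_j + i q_j)`. -/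
def cauchyRiemannTranspose (h c : ℝ) (j : Fin n) (φ : Phase n → ℂ) (w : Phase n) : ℂ :=
  -((h : ℂ) / 2) * (fderiv ℝ φ w (0, EuclideanSpace.single j 1) +
      c * I * fderiv ℝ φ w (EuclideanSpace.single j 1, 0)) +
    2 * Real.pi * (c * w.2 j + I * w.1 j) * φ w

/-- `D^j f = 0` in the sense of distributions. -/
def IsNullSolution (h c : ℝ) (j : Fin n) (f : Phase n → ℂ) : Prop :=
  ∀ φ : Phase n → ℂ, ContDiff ℝ ∞ φ → HasCompactSupport φ →
    ∫ w, f w * cauchyRiemannTranspose h c j φ w = 0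

theorem memLp_cauchyRiemannTranspose (h c : ℝ) (j : Fin n) {φ : Phase n → ℂ}
    (hφ : ContDiff ℝ ∞ φ) (hc : HasCompactSupport φ) :
    MemLp (cauchyRiemannTranspose h c j φ) 2 volume := by
  have hd : Continuous (fderiv ℝ φ) := hφ.continuous_fderiv (by simp)
  have h0 : Continuous φ := hφ.continuous
  have hcont : Continuous (cauchyRiemannTranspose h c j φ) := by
    unfold cauchyRiemannTranspose
    fun_prop
  refine hcont.memLp_of_hasCompactSupport ?_
  refine HasCompactSupport.intro hc (fun w hw => ?_)
  have h1 : φ w = 0 := image_eq_zero_of_notMem_tsupport hw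
  have h2 : fderiv ℝ φ w = 0 :=
    image_eq_zero_of_notMem_tsupport fun hw' => hw (tsupport_fderiv_subset ℝ hw')
  simp [cauchyRiemannTranspose, h1, h2]

/-- The Fock space `F₂(O_h)`: the square integrable null solutions of all `D^j`. -/
def Fock (n : ℕ) (h c : ℝ) : Submodule ℂ (Lp ℂ 2 (volume : Measure (Phase n))) where
  carrier := {f | ∀ j, IsNullSolution h c j f}
  zero_mem' := by
    intro j φ _ _
    refine integral_eq_zero_of_ae ?_
    filter_upwards [Lp.coeFn_zero ℂ 2 (volume : Measure (Phase n))] with w hw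
    rw [hw]; simp
  add_mem' := by
    intro f f' hf hf' j φ hφ hφc
    have hm := memLp_cauchyRiemannTranspose h c j hφ hφc
    have h1 : ∫ w, (f + f' : Lp ℂ 2 (volume : Measure (Phase n))) w *
        cauchyRiemannTranspose h c j φ w = ∫ w, (f w * cauchyRiemannTranspose h c j φ w +
          f' w * cauchyRiemannTranspose h c j φ w) := by
      refine integral_congr_ae ?_
      filter_upwards [Lp.coeFn_add f f'] with w hw
      rw [hw, Pi.add_apply, add_mul]
    have hi := (Lp.memLp f).integrable_mul hm
    have hi' := (Lp.memLp f').integrable_mul hm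
    simp only [Pi.mul_def] at hi hi'
    rw [h1, integral_add hi hi', hf j φ hφ hφc,
      hf' j φ hφ hφc, add_zero]
  smul_mem' := by
    intro a f hf j φ hφ hφc
    have h1 : ∫ w, (a • f : Lp ℂ 2 (volume : Measure (Phase n))) w *
        cauchyRiemannTranspose h c j φ w =
        ∫ w, a * (f w * cauchyRiemannTranspose h c j φ w) := by
      refine integral_congr_ae ?_
      filter_upwards [Lp.coeFn_smul a f] with w hw
      rw [hw, Pi.smul_apply, smul_eq_mul, mul_assoc]
    rw [h1, integral_const_mul, hf j φ hφ hφc, mul_zero]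

theorem mem_Fock {h c : ℝ} {f : Lp ℂ 2 (volume : Measure (Phase n))} :
    f ∈ Fock n h c ↔ ∀ j, IsNullSolution h c j f := Iff.rfl

theorem isClosed_Fock (n : ℕ) (h c : ℝ) :
    IsClosed (Fock n h c : Set (Lp ℂ 2 (volume : Measure (Phase n)))) := by
  have hset : (Fock n h c : Set (Lp ℂ 2 (volume : Measure (Phase n)))) =
      {f | ∀ j : Fin n, ∀ φ : Phase n → ℂ, ContDiff ℝ ∞ φ → HasCompactSupport φ →
        ∫ w, f w * cauchyRiemannTranspose h c j φ w = 0} := rfl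
  rw [hset]
  simp only [Set.ofPred_forall]
  refine isClosed_iInter fun j => isClosed_iInter fun φ => isClosed_iInter fun hφ =>
    isClosed_iInter fun hφc => ?_
  have hm := memLp_cauchyRiemannTranspose h c j hφ hφc
  have hstar : MemLp (star (cauchyRiemannTranspose h c j φ)) 2 volume := hm.star
  have h1 : ∀ f : Lp ℂ 2 (volume : Measure (Phase n)),
      ∫ w, f w * cauchyRiemannTranspose h c j φ w = ⟪hstar.toLp, f⟫_ℂ := by
    intro f
    rw [L2.inner_def]
    refine integral_congr_ae ?_
    filter_upwards [hstar.coeFn_toLp] with w hw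
    rw [hw]; simp [RCLike.inner_apply]
  simp only [h1]
  exact isClosed_eq (by fun_prop) continuous_const

instance (n : ℕ) (h c : ℝ) : CompleteSpace (Fock n h c) :=
  (isClosed_Fock n h c).completeSpace_coe

/-- The Fock space is invariant under `ρ_h`. -/
theorem repLp_mem_Fock (h c : ℝ) (g : Heisenberg n) {f : Lp ℂ 2 (volume : Measure (Phase n))}
    (hf : f ∈ Fock n h c) : repLp h g f ∈ Fock n h c := by
  intro j φ hφ hφc
  set a := repShift h g with ha
  let ψ : Phase n → ℂ := fun w => cexp (repPhase h g (w - a) * I) * φ (w - a)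
  have hθ : ContDiff ℝ ∞ (repPhase h g) := by
    unfold repPhase
    exact contDiff_const.mul ((contDiff_const.add (contDiff_fst.inner ℝ contDiff_const)).add
      (contDiff_snd.inner ℝ contDiff_const))
  have hψ : ContDiff ℝ ∞ ψ := by
    have h1 : ContDiff ℝ ∞ fun w : Phase n => w - a := by fun_prop
    have h2 : ContDiff ℝ ∞ fun w => ((repPhase h g (w - a) : ℝ) : ℂ) :=
      Complex.ofRealCLM.contDiff.comp (hθ.comp h1)
    exact ((h2.mul contDiff_const).cexp).mul (hφ.comp h1)
  have hψc : HasCompactSupport ψ := by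
    refine HasCompactSupport.mul_left ?_
    exact hφc.comp_homeomorph (Homeomorph.subRight a)
  have key := hf j ψ hψ hψc
  have hD : ∀ w, cauchyRiemannTranspose h c j ψ (w + a) =
      cexp (repPhase h g w * I) * cauchyRiemannTranspose h c j φ w := by
    intro w
    have hdφ : HasFDerivAt φ (fderiv ℝ φ w) (w + a - a) := by
      rw [add_sub_cancel_right]
      exact (hφ.differentiable (by simp) w).hasFDerivAt
    let Λ : Phase n →L[ℝ] ℝ := (-(2 * Real.pi)) •
      ((innerSL ℝ g.x).comp (ContinuousLinearMap.fst ℝ (RSpace n) (RSpace n)) +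
        (innerSL ℝ g.y).comp (ContinuousLinearMap.snd ℝ (RSpace n) (RSpace n)))
    have hΛ : HasFDerivAt (repPhase h g) Λ (w + a - a) := by
      have h1 : repPhase h g = fun v => Λ v + (-(2 * Real.pi)) * (h * g.s) := by
        funext v
        simp only [repPhase, Λ, smul_apply, add_apply,
          ContinuousLinearMap.comp_apply, ContinuousLinearMap.coe_fst',
          ContinuousLinearMap.coe_snd', innerSL_apply_apply, smul_eq_mul,
          real_inner_comm v.1, real_inner_comm v.2]
        ring
      rw [h1]
      exact Λ.hasFDerivAt.add_const _
    have hsub : HasFDerivAt (fun v : Phase n => v - a) (ContinuousLinearMap.id ℝ (Phase n))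
        (w + a) := (hasFDerivAt_id _).sub_const a
    have hΛs := HasFDerivAt.comp (f := fun v : Phase n => v - a) (w + a) hΛ hsub
    have hφs := HasFDerivAt.comp (f := fun v : Phase n => v - a) (w + a) hdφ hsub
    have h2 := (((Complex.ofRealCLM.hasFDerivAt.comp (w + a) hΛs).mul_const I).cexp).mul hφs
    have hfd : ∀ v, fderiv ℝ ψ (w + a) v = cexp (repPhase h g w * I) *
        (fderiv ℝ φ w v + (Λ v : ℂ) * I * φ w) := by
      intro v
      have h3 := h2.fderiv
      have h4 : fderiv ℝ ψ (w + a) = _ := h3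
      rw [h4]
      simp [add_sub_cancel_right]
      ring
    have hψv : ψ (w + a) = cexp (repPhase h g w * I) * φ w := by
      simp only [ψ, add_sub_cancel_right]
    have hΛ1 : Λ (EuclideanSpace.single j 1, 0) = -(2 * Real.pi) * g.x j := by
      simp [Λ, EuclideanSpace.inner_single_right]
    have hΛ2 : Λ (0, EuclideanSpace.single j 1) = -(2 * Real.pi) * g.y j := by
      simp [Λ, EuclideanSpace.inner_single_right]
    simp only [cauchyRiemannTranspose]
    rw [hfd, hfd, hψv, hΛ1, hΛ2]
    simp only [ha, repShift, Prod.fst_add, Prod.snd_add, PiLp.add_apply, PiLp.neg_apply,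
      PiLp.smul_apply, smul_eq_mul]
    push_cast
    linear_combination (h * cexp (repPhase h g w * I) * Real.pi * φ w * c * g.x j) * I_sq
  rw [← key, ← (measurePreserving_repShift h g).integral_comp
    (measurableEmbedding_addRight (repShift h g)) (fun w => f w * cauchyRiemannTranspose h c j ψ w)]
  refine integral_congr_ae ?_
  filter_upwards [coeFn_repLp h g f] with w hw
  rw [hw, repFun_apply, ← ha, hD]
  ring

/-- The unitary representation `ρ_h` of `ℍⁿ` on the Fock space. -/
def rep (h c : ℝ) (g : Heisenberg n) : Fock n h c →L[ℂ] Fock n h c :=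
  ((repLp h g).toContinuousLinearMap.comp (Fock n h c).subtypeL).codRestrict (Fock n h c)
    fun f => repLp_mem_Fock h c g f.2

theorem coe_rep (h c : ℝ) (g : Heisenberg n) (f : Fock n h c) :
    (rep h c g f : Lp ℂ 2 (volume : Measure (Phase n))) = repLp h g f := rfl

theorem norm_rep (h c : ℝ) (g : Heisenberg n) (f : Fock n h c) : ‖rep h c g f‖ = ‖f‖ :=
  (repLp h g).norm_map _

theorem continuous_rep (h c : ℝ) (f : Fock n h c) :
    Continuous fun v : ℝ × RSpace n × RSpace n => rep h c (Heisenberg.coords.symm v) f :=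
  Continuous.subtype_mk (continuous_repLp h (f : Lp ℂ 2 (volume : Measure (Phase n)))) _

end Fock

section Transforms

variable {n : ℕ}

/-- The vacuum `v₀(q,p) = exp(-(2π/h)(c⁻¹ q² + c p²))` as a function. -/
def vacuumFun (h c : ℝ) (w : Phase n) : ℂ :=
  (Real.exp (-(2 * Real.pi / h) * (c⁻¹ * ‖w.1‖ ^ 2 + c * ‖w.2‖ ^ 2)) : ℝ)

theorem contDiff_vacuumFun (h c : ℝ) : ContDiff ℝ ∞ (vacuumFun (n := n) h c) := by
  unfold vacuumFun
  refine Complex.ofRealCLM.contDiff.comp (ContDiff.exp (contDiff_const.mul ?_))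
  exact (contDiff_const.mul (contDiff_fst.norm_sq ℝ)).add
    (contDiff_const.mul (contDiff_snd.norm_sq ℝ))

theorem integrable_gaussian {a : ℝ} (ha : 0 < a) :
    Integrable (fun v : RSpace n => Real.exp (-a * ‖v‖ ^ 2)) := by
  have h1 := (GaussianFourier.integrable_cexp_neg_mul_sq_norm_add (V := RSpace n)
    (b := (a : ℂ)) (by simpa using ha) 0 0).norm
  refine h1.congr (Filter.Eventually.of_forall fun v => ?_)
  simp only [Complex.norm_exp]
  congr 1
  simp [← ofReal_pow]

theorem memLp_vacuumFun {h c : ℝ} (hh : 0 < h) (hc : 0 < c) :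
    MemLp (vacuumFun (n := n) h c) 2 volume := by
  rw [memLp_two_iff_integrable_sq_norm
    (contDiff_vacuumFun h c).continuous.aestronglyMeasurable]
  have hp := Real.pi_pos
  have h1 : Integrable (fun w : Phase n =>
      Real.exp (-(4 * Real.pi / h * c⁻¹) * ‖w.1‖ ^ 2) *
        Real.exp (-(4 * Real.pi / h * c) * ‖w.2‖ ^ 2)) :=
    (integrable_gaussian (by positivity)).mul_prod (integrable_gaussian (by positivity))
  refine h1.congr (Filter.Eventually.of_forall fun w => ?_)
  simp only [vacuumFun, Complex.norm_real, Real.norm_eq_abs, Real.abs_exp, ← Real.exp_add,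
    ← Real.exp_nat_mul]
  congr 1
  push_cast
  ring

theorem fderiv_vacuumFun (h c : ℝ) (w v : Phase n) :
    fderiv ℝ (vacuumFun (n := n) h c) w v =
      ((-(4 * Real.pi / h) * (c⁻¹ * ⟪w.1, v.1⟫_ℝ + c * ⟪w.2, v.2⟫_ℝ) : ℝ) : ℂ) *
        vacuumFun h c w := by
  have h1 : HasFDerivAt (fun w : Phase n => ‖w.1‖ ^ 2) _ w := hasFDerivAt_fst.norm_sq
  have h2 : HasFDerivAt (fun w : Phase n => ‖w.2‖ ^ 2) _ w := hasFDerivAt_snd.norm_sq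
  have h3 := ((((h1.const_mul c⁻¹).add (h2.const_mul c)).const_mul (-(2 * Real.pi / h))).exp)
  have h4 := Complex.ofRealCLM.hasFDerivAt.comp w h3
  have h5 : fderiv ℝ (vacuumFun (n := n) h c) w = _ := h4.fderiv
  rw [h5]
  simp [vacuumFun]
  ring

theorem isNullSolution_vacuumFun {h c : ℝ} (hh : 0 < h) (hc : 0 < c) (j : Fin n) :
    IsNullSolution h c j (vacuumFun (n := n) h c) := by
  intro φ hφ hφc
  have hv := contDiff_vacuumFun (n := n) h c
  have hvc := hv.continuous
  have hφd : Continuous (fderiv ℝ φ) := hφ.continuous_fderiv (by simp)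
  have hφ0 := hφ.continuous
  have hvd : Continuous (fderiv ℝ (vacuumFun (n := n) h c)) := hv.continuous_fderiv (by simp)
  have hφdc : HasCompactSupport (fderiv ℝ φ) := hφc.fderiv ℝ
  have i1 : ∀ v, Integrable (fun w => vacuumFun h c w * fderiv ℝ φ w v) := fun v =>
    Continuous.integrable_of_hasCompactSupport (by fun_prop)
      (HasCompactSupport.mul_left (hφdc.comp_left (g := fun L : Phase n →L[ℝ] ℂ => L v) rfl))
  have i2 : ∀ v, Integrable (fun w => fderiv ℝ (vacuumFun (n := n) h c) w v * φ w) := fun v =>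
    Continuous.integrable_of_hasCompactSupport (by fun_prop) (HasCompactSupport.mul_left hφc)
  have i3 : Integrable (fun w => vacuumFun h c w * φ w) :=
    Continuous.integrable_of_hasCompactSupport (by fun_prop) (HasCompactSupport.mul_left hφc)
  have i4 : Integrable (fun w : Phase n => vacuumFun h c w *
      (2 * Real.pi * (c * w.2 j + I * w.1 j) * φ w)) :=
    Continuous.integrable_of_hasCompactSupport (by fun_prop)
      (HasCompactSupport.mul_left (HasCompactSupport.mul_left hφc))
  have parts : ∀ v, ∫ w, vacuumFun h c w * fderiv ℝ φ w v =
      -∫ w, fderiv ℝ (vacuumFun (n := n) h c) w v * φ w := fun v =>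
    integral_mul_fderiv_eq_neg_fderiv_mul_of_integrable (i2 v) (i1 v) i3
      (fun w _ => hv.differentiable (by simp) w) (fun w _ => hφ.differentiable (by simp) w)
  set e₁ : Phase n := (0, EuclideanSpace.single j 1)
  set e₂ : Phase n := (EuclideanSpace.single j 1, 0)
  have hsplit : ∀ w, vacuumFun h c w * cauchyRiemannTranspose h c j φ w =
      (-((h : ℂ) / 2) * (vacuumFun h c w * fderiv ℝ φ w e₁) +
        -((h : ℂ) / 2) * (c * I) * (vacuumFun h c w * fderiv ℝ φ w e₂)) +
        vacuumFun h c w * (2 * Real.pi * (c * w.2 j + I * w.1 j) * φ w) := by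
    intro w
    simp only [cauchyRiemannTranspose, e₁, e₂]
    ring
  have hh' : (h : ℂ) ≠ 0 := by exact_mod_cast hh.ne'
  have hc' : (c : ℂ) ≠ 0 := by exact_mod_cast hc.ne'
  have hlast : ∀ w : Phase n, vacuumFun h c w * (2 * Real.pi * (c * w.2 j + I * w.1 j) * φ w) =
      -((h : ℂ) / 2) * (fderiv ℝ (vacuumFun (n := n) h c) w e₁ * φ w) +
        -((h : ℂ) / 2) * (c * I) * (fderiv ℝ (vacuumFun (n := n) h c) w e₂ * φ w) := by
    intro w
    simp only [fderiv_vacuumFun, e₁, e₂, inner_zero_right, EuclideanSpace.inner_single_right]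
    push_cast
    simp
    field_simp
    ring
  have j1 : Integrable (fun w => -((h : ℂ) / 2) * (vacuumFun h c w * fderiv ℝ φ w e₁)) :=
    (i1 e₁).const_mul _
  have j2 : Integrable (fun w => -((h : ℂ) / 2) * (c * I) *
      (vacuumFun h c w * fderiv ℝ φ w e₂)) := (i1 e₂).const_mul _
  have j3 : Integrable (fun w => -((h : ℂ) / 2) * (vacuumFun h c w * fderiv ℝ φ w e₁) +
      -((h : ℂ) / 2) * (c * I) * (vacuumFun h c w * fderiv ℝ φ w e₂)) := j1.add j2
  simp only [hsplit]
  rw [integral_add j3 i4, integral_add j1 j2]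
  simp only [hlast]
  rw [integral_add ((i2 e₁).const_mul _) ((i2 e₂).const_mul _)]
  simp only [integral_const_mul, parts]
  ring

/-- The vacuum vector `v₀` of the Fock space. -/
def vacuum {h c : ℝ} (hh : 0 < h) (hc : 0 < c) : Fock n h c :=
  ⟨(memLp_vacuumFun hh hc).toLp _, by
    intro j φ hφ hφc
    rw [← isNullSolution_vacuumFun hh hc j φ hφ hφc]
    refine integral_congr_ae ?_
    filter_upwards [(memLp_vacuumFun (n := n) hh hc).coeFn_toLp] with w hw
    rw [hw]⟩

/-- The coherent states `v_{(x,y)} = ρ_h(0,x,y) v₀`. -/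
def coherent {h c : ℝ} (hh : 0 < h) (hc : 0 < c) (z : Phase n) : Fock n h c :=
  rep h c (Heisenberg.lift z) (vacuum hh hc)

/-- The normalised inner product `⟨f₁, f₂⟩ = (4/h)ⁿ ∫ f₁ f̄₂ dq dp`, linear in `f₁`. -/
def fockInner {h c : ℝ} (f₁ f₂ : Fock n h c) : ℂ :=
  ((4 / h : ℝ) : ℂ) ^ n * ∫ w, (f₁ : Lp ℂ 2 (volume : Measure (Phase n))) w *
    (starRingEnd ℂ) ((f₂ : Lp ℂ 2 (volume : Measure (Phase n))) w)

/-- Absolute convergence of the integral that defines the trace of `A`. -/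
def HasCoherentTrace {h c : ℝ} (hh : 0 < h) (hc : 0 < c) (A : Fock n h c →L[ℂ] Fock n h c) :
    Prop :=
  Integrable fun z : Phase n => fockInner (A (coherent hh hc z)) (coherent hh hc z)

/-- The trace `tr A = hⁿ ∫ ⟨A v_{(x,y)}, v_{(x,y)}⟩ dx dy`. -/
def coherentTrace {h c : ℝ} (hh : 0 < h) (hc : 0 < c) (A : Fock n h c →L[ℂ] Fock n h c) : ℂ :=
  (h : ℂ) ^ n * ∫ z : Phase n, fockInner (A (coherent hh hc z)) (coherent hh hc z)

/-- The operator `ρ_h((0,x,y)⁻¹) A`. -/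
def shiftOperator {h c : ℝ} (A : Fock n h c →L[ℂ] Fock n h c) (z : Phase n) :
    Fock n h c →L[ℂ] Fock n h c :=
  (rep h c (Heisenberg.lift z)⁻¹).comp A

/-- The reduced wavelet transform `(W_r A)(x,y) = tr(ρ_h((0,x,y)⁻¹) A)`. -/
def reducedWavelet {h c : ℝ} (hh : 0 < h) (hc : 0 < c) (A : Fock n h c →L[ℂ] Fock n h c)
    (z : Phase n) : ℂ :=
  coherentTrace hh hc (shiftOperator A z)

/-- The strong integral `f ↦ ∫ a(t) U(t) f dμ(t)` of contractions against an integrable `a`. -/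
def strongIntegral {α H : Type*} [MeasurableSpace α] [NormedAddCommGroup H] [NormedSpace ℂ H]
    (μ : Measure α) (a : α → ℂ) (ha : Integrable a μ) (U : α → H →L[ℂ] H)
    (hU : ∀ f, AEStronglyMeasurable (fun t => U t f) μ) (hU1 : ∀ t f, ‖U t f‖ ≤ ‖f‖) :
    H →L[ℂ] H :=
  have hint : ∀ f, Integrable (fun t => a t • U t f) μ := fun f =>
    (ha.norm.mul_const ‖f‖).mono' (ha.1.smul (hU f)) (Filter.Eventually.of_forall fun t => by
      rw [norm_smul]; exact mul_le_mul_of_nonneg_left (hU1 t f) (norm_nonneg _))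
  LinearMap.mkContinuous
    { toFun := fun f => ∫ t, a t • U t f ∂μ
      map_add' := fun f f' => by
        simp only [map_add, smul_add]
        exact integral_add (hint f) (hint f')
      map_smul' := fun r f => by
        simp only [map_smul, RingHom.id_apply]
        rw [← integral_smul]
        simp only [smul_comm r] }
    (∫ t, ‖a t‖ ∂μ) (fun f => by
      rw [← integral_mul_const]
      refine norm_integral_le_of_norm_le (ha.norm.mul_const ‖f‖)
        (Filter.Eventually.of_forall fun t => ?_)
      rw [norm_smul]; exact mul_le_mul_of_nonneg_left (hU1 t f) (norm_nonneg _))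

theorem aestronglyMeasurable_rep (h c : ℝ) (f : Fock n h c) :
    AEStronglyMeasurable (fun g : Heisenberg n => rep h c g f) volume := by
  have h1 := ((continuous_rep h c f).stronglyMeasurable).comp_measurable
    (Heisenberg.measurable_coords (n := n))
  exact h1.aestronglyMeasurable

theorem aestronglyMeasurable_rep_lift (h c : ℝ) (f : Fock n h c) :
    AEStronglyMeasurable (fun z : Phase n => rep h c (Heisenberg.lift z) f) volume := by
  have h1 : Continuous fun z : Phase n => ((0 : ℝ), z.1, z.2) := by fun_prop
  exact ((continuous_rep h c f).comp h1).aestronglyMeasurable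

/-- The image `ρ_h(k) = κ^{n+1} ∫ k(g) ρ_h(g) dg` of a convolution kernel `k ∈ L¹(ℍⁿ)`. -/
def repKernel (h c κ : ℝ) (k : Heisenberg n → ℂ) (hk : Integrable k) :
    Fock n h c →L[ℂ] Fock n h c :=
  (κ : ℂ) ^ (n + 1) • strongIntegral volume k hk (rep h c) (aestronglyMeasurable_rep h c)
    (fun g f => (norm_rep h c g f).le)

/-- The inverse transform `M_r a = hⁿ ∫ a(x,y) ρ_h(0,x,y) dx dy`. -/
def inverseWavelet (h c : ℝ) (a : Phase n → ℂ) (ha : Integrable a) :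
    Fock n h c →L[ℂ] Fock n h c :=
  (h : ℂ) ^ n • strongIntegral volume a ha (fun z => rep h c (Heisenberg.lift z))
    (aestronglyMeasurable_rep_lift h c) (fun _ f => (norm_rep h c _ f).le)

end Transforms

end

/-! The centre of the group acts through the character `e^{-2πihs}`. Integrating over `s` first
therefore shows that `ρ_h(k)` depends only on the central Fourier transform `b(x,y) = ∫ k(s,x,y)
e^{-2πihs} ds`, an `L¹` function: `ρ_h(k) = κ^{n+1} ∫ b(w) ρ_h(0,w) dw`
(`integral_centralFourier_smul_rep`). It remains to identify the wavelet transform with `h^{-n}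
κ^{n+1} b`.

The vacuum coefficient of `ρ_h(0,u)` is a positive Gaussian `G(u)`, and conjugating by `(0,z')` only
adds a phase linear in `z'`. Hence the integrand of the trace at `z`, as a function of `z'`, is
`κ^{n+1}` times the Fourier transform of `F_z(u) = b(z+u) e^{πihω(z,u)} G(u)` at a frequency
proportional to a rotation of `z'` (`fockInner_shiftOperator_repKernel`). So the trace exists
exactly when the transform of `F_z` is integrable, and formally Fourier inversion at `u = 0` gives
`F_z(0) = b(z)`.

The delicate point is that `b` is only an `L¹` class, while inversion at a point needs continuity.
Existence of the trace at a single `z` supplies it: a.e. inversion gives `F_z` a continuous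
representative, and dividing by the nowhere vanishing twist gives one for `b`
(`exists_continuous_ae_eq_of_twistedGaussian`). Inversion at `0` then yields the transform for a.e.
`z` (`reducedWavelet_ae_eq`).

For Schwartz `k`, the transform of `F_z` is a slice of the full Fourier transform of a Schwartz
function on `ℝ^{1+2n}`, hence integrable (`integrable_phaseFourier_of_schwartz`). -/

noncomputable section

/-! ### Fourier inversion for integrable functions, almost everywhere. -/

section FourierInversion

open FourierTransform

variable {V : Type*} [NormedAddCommGroup V] [InnerProductSpace ℝ V] [FiniteDimensional ℝ V]
  [MeasurableSpace V] [BorelSpace V]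

theorem MeasureTheory.Integrable.integral_fourier_mul_eq {f g : V → ℂ} (hf : Integrable f)
    (hg : Integrable g) : ∫ v, 𝓕 f v * g v = ∫ v, f v * 𝓕 g v := by
  have := VectorFourier.integral_bilin_fourierIntegral_eq_flip (ContinuousLinearMap.mul ℂ ℂ)
    (L := innerₗ V) Real.continuous_fourierChar continuous_inner hf hg
  simpa using! this

theorem MeasureTheory.Integrable.integral_fourierInv_mul_eq {f g : V → ℂ} (hf : Integrable f)
    (hg : Integrable g) : ∫ v, 𝓕⁻ f v * g v = ∫ v, f v * 𝓕⁻ g v := by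
  rw [Real.fourierInv_eq_fourier_comp_neg g, ← hf.integral_fourier_mul_eq hg.comp_neg,
    ← integral_neg_eq_self]
  simp [Real.fourierInv_eq_fourier_neg]

theorem continuous_fourier_of_integrable {f : V → ℂ} (hf : Integrable f) : Continuous (𝓕 f) :=
  VectorFourier.fourierIntegral_continuous Real.continuous_fourierChar
    (L := innerₗ V) continuous_inner hf

theorem continuous_fourierInv_of_integrable {f : V → ℂ} (hf : Integrable f) :
    Continuous (𝓕⁻ f) := by
  have h1 : 𝓕⁻ f = fun v => 𝓕 f (-v) := by
    funext v
    exact Real.fourierInv_eq_fourier_neg f v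
  rw [h1]
  exact (continuous_fourier_of_integrable hf).comp continuous_neg

/-- Fourier inversion almost everywhere, without continuity of the function. -/
theorem MeasureTheory.Integrable.ae_eq_fourierInv_fourier {f : V → ℂ} (hf : Integrable f)
    (h'f : Integrable (𝓕 f)) : f =ᵐ[volume] 𝓕⁻ (𝓕 f) := by
  refine ae_eq_of_integral_contDiff_smul_eq hf.locallyIntegrable
    (continuous_fourierInv_of_integrable h'f).locallyIntegrable fun g hg hgc => ?_
  have hg₁ : HasCompactSupport (Complex.ofRealCLM ∘ g) := hgc.comp_left rfl
  have hg₂ : ContDiff ℝ ∞ (Complex.ofRealCLM ∘ g) := by fun_prop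
  set φ : SchwartzMap V ℂ := hg₁.toSchwartzMap hg₂ with hφ
  have hφg : ∀ v, φ v = (g v : ℂ) := fun v => rfl
  -- Each test function is the Fourier transform of an integrable function, so both sides can be
  -- moved onto the common pairing of `𝓕 f` with `𝓕⁻ φ`.
  have hinv : 𝓕 (𝓕⁻ (φ : V → ℂ)) = φ := by
    rw [← SchwartzMap.fourierInv_coe, ← SchwartzMap.fourier_coe,
      FourierTransform.fourier_fourierInv_eq]
  have hint : Integrable (𝓕⁻ (φ : V → ℂ)) := by
    rw [← SchwartzMap.fourierInv_coe]
    exact (𝓕⁻ φ).integrable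
  have h1 := hf.integral_fourier_mul_eq hint
  have h2 := h'f.integral_fourierInv_mul_eq φ.integrable
  rw [hinv] at h1
  simp only [Complex.real_smul, ← hφg]
  calc ∫ v, φ v * f v = ∫ v, f v * φ v := by simp only [mul_comm]
    _ = ∫ v, 𝓕⁻ (𝓕 f) v * φ v := by rw [← h1, h2]
    _ = _ := by simp only [mul_comm]

end FourierInversion

/-! ### Fourier transform and inversion on `ℝ²ⁿ` in product coordinates. -/

section PhaseFourier

variable {n : ℕ}

/-- The Fourier transform on `ℝ²ⁿ`. -/
def phaseFourier (f : Phase n → ℂ) (ξ : Phase n) : ℂ :=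
  ∫ u : Phase n, cexp ((-(2 * Real.pi) * (⟪u.1, ξ.1⟫_ℝ + ⟪u.2, ξ.2⟫_ℝ) : ℝ) * I) * f u

theorem phaseFourier_congr {f f' : Phase n → ℂ} (hf : f =ᵐ[volume] f') :
    phaseFourier f = phaseFourier f' := by
  funext ξ
  exact integral_congr_ae (hf.mono fun u hu => by simp only [hu])

open FourierTransform in
-- `Phase n` carries the sup norm, so the inner product Fourier theory lives on `WithLp 2 (Phase
-- n)`; forgetting the norm preserves Lebesgue measure, which transports results between the two.
theorem fourier_comp_ofLp (f : Phase n → ℂ) (ξ : WithLp 2 (Phase n)) :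
    𝓕 (fun v : WithLp 2 (Phase n) => f v.ofLp) ξ = phaseFourier f ξ.ofLp := by
  rw [phaseFourier, ← (WithLp.volume_preserving_ofLp (RSpace n) (RSpace n)).integral_comp
    (MeasurableEquiv.toLp 2 (Phase n)).symm.measurableEmbedding, Real.fourier_eq']
  simp [WithLp.prod_inner_apply]

open FourierTransform in
theorem integrable_fourier_comp_ofLp {f : Phase n → ℂ} (h'f : Integrable (phaseFourier f)) :
    Integrable (𝓕 (fun v : WithLp 2 (Phase n) => f v.ofLp)) := by
  have h1 := ((WithLp.volume_preserving_ofLp (RSpace n) (RSpace n)).integrable_comp_emb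
    (MeasurableEquiv.toLp 2 (Phase n)).symm.measurableEmbedding).2 h'f
  exact h1.congr (Filter.Eventually.of_forall fun ξ => (fourier_comp_ofLp f ξ).symm)

theorem integrable_comp_ofLp {f : Phase n → ℂ} (hf : Integrable f) :
    Integrable (fun v : WithLp 2 (Phase n) => f v.ofLp) :=
  ((WithLp.volume_preserving_ofLp (RSpace n) (RSpace n)).integrable_comp_emb
    (MeasurableEquiv.toLp 2 (Phase n)).symm.measurableEmbedding).2 hf

/-- The representative is the inverse transform of the integrable function `phaseFourier f`. -/
theorem exists_continuous_ae_eq {f : Phase n → ℂ} (hf : Integrable f)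
    (h'f : Integrable (phaseFourier f)) : ∃ g : Phase n → ℂ, Continuous g ∧ f =ᵐ[volume] g := by
  have h1 := (integrable_comp_ofLp hf).ae_eq_fourierInv_fourier (integrable_fourier_comp_ofLp h'f)
  refine ⟨_, (continuous_fourierInv_of_integrable (integrable_fourier_comp_ofLp h'f)).comp
    (WithLp.prod_continuous_toLp 2 (RSpace n) (RSpace n)), ?_⟩
  exact (WithLp.volume_preserving_toLp (RSpace n) (RSpace n)).quasiMeasurePreserving.ae h1

open FourierTransform in
-- Pointwise inversion at the origin, where the inverse transform is the plain integral.
theorem integral_phaseFourier {f : Phase n → ℂ} (hf : Integrable f)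
    (h'f : Integrable (phaseFourier f)) (hc : ContinuousAt f 0) :
    ∫ ξ, phaseFourier f ξ = f 0 := by
  have h1 := (integrable_comp_ofLp hf).fourierInv_fourier_eq (integrable_fourier_comp_ofLp h'f)
    (v := 0) (ContinuousAt.comp (x := (0 : WithLp 2 (Phase n))) (by simpa using hc)
      (WithLp.prod_continuous_ofLp 2 (RSpace n) (RSpace n)).continuousAt)
  rw [Real.fourierInv_eq'] at h1
  rw [← (WithLp.volume_preserving_ofLp (RSpace n) (RSpace n)).integral_comp
    (MeasurableEquiv.toLp 2 (Phase n)).symm.measurableEmbedding]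
  simpa [fourier_comp_ofLp] using h1

end PhaseFourier

/-! ### The symplectic form and the associated change of frequency. -/

section Symplectic

variable {n : ℕ}

/-- The symplectic form `x·y' - x'·y` on `ℝ²ⁿ`. -/
def sympForm (z w : Phase n) : ℝ := ⟪z.1, w.2⟫_ℝ - ⟪w.1, z.2⟫_ℝ

/-- The frequency `ξ` with `ξ·u = -h ω(z,u)`. -/
def sympFreq (h : ℝ) (z : Phase n) : Phase n := h • (z.2, -z.1)

theorem measurePreserving_swap_neg :
    MeasurePreserving (fun z : Phase n => ((z.2, -z.1) : Phase n)) volume volume := by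
  have h1 : MeasurePreserving (Prod.swap : Phase n → Phase n) volume volume :=
    Measure.measurePreserving_swap
  have h2 : MeasurePreserving (Prod.map id (Neg.neg) : Phase n → Phase n) volume volume :=
    (MeasurePreserving.id _).prod (Measure.measurePreserving_neg _)
  exact h2.comp h1

theorem measurableEmbedding_swap_neg :
    MeasurableEmbedding (fun z : Phase n => ((z.2, -z.1) : Phase n)) := by
  have h2 : MeasurableEmbedding (Prod.map id (Neg.neg) : Phase n → Phase n) :=
    ((MeasurableEquiv.refl _).prodCongr (MeasurableEquiv.neg (RSpace n))).measurableEmbedding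
  exact h2.comp (MeasurableEquiv.prodComm (α := RSpace n) (β := RSpace n)).measurableEmbedding

theorem integrable_comp_sympFreq {h : ℝ} (hh : 0 < h) {F : Phase n → ℂ} :
    Integrable (fun z => F (sympFreq h z)) ↔ Integrable F := by
  rw [← integrable_comp_smul_iff volume F hh.ne']
  exact measurePreserving_swap_neg.integrable_comp_emb measurableEmbedding_swap_neg
    (g := fun z : Phase n => F (h • z))

/-- The map is a measure preserving rotation followed by dilation by `h` in real dimension `2n`. -/
theorem integral_comp_sympFreq {h : ℝ} (hh : 0 < h) (F : Phase n → ℂ) :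
    ∫ z, F (sympFreq h z) = ((h : ℂ) ^ (2 * n))⁻¹ * ∫ ξ, F ξ := by
  have h1 := measurePreserving_swap_neg.integral_comp measurableEmbedding_swap_neg
    (fun z : Phase n => F (h • z))
  have h2 := Measure.integral_comp_smul (volume : Measure (Phase n)) F h
  have h3 : Module.finrank ℝ (Phase n) = 2 * n := by simp [Module.finrank_prod]; ring
  rw [h3, abs_of_pos (by positivity), Complex.real_smul] at h2
  calc ∫ z, F (sympFreq h z) = ∫ z : Phase n, F (h • z) := h1
    _ = _ := by rw [h2]; push_cast; rfl

end Symplectic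

/-! ### The group law of `ρ_h` and its coefficients at coherent states. -/

section MatrixCoefficients

variable {n : ℕ}

theorem rep_mul (h c : ℝ) (a b : Heisenberg n) (f : Fock n h c) :
    rep h c (a * b) f = rep h c a (rep h c b f) := by
  apply Subtype.ext
  simp only [coe_rep]
  apply Lp.ext
  refine (coeFn_repLp h _ _).trans (Filter.EventuallyEq.trans ?_ ((coeFn_repLp h a _).trans
    (repFun_congr h a (coeFn_repLp h b _))).symm)
  refine Filter.Eventually.of_forall fun w => ?_
  simp only [repFun, Heisenberg.mul_x, Heisenberg.mul_y]
  rw [← mul_assoc, ← Complex.exp_add]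
  congr 1
  · congr 1
    rw [← add_mul, ← ofReal_add]
    congr 2
    -- Evaluating the phase of `b` at the point shifted by `a` produces the term `(h/2)(a.x·b.y -
    -- b.x·a.y)`, which is `h` times the cocycle of the group law.
    simp only [repPhase, Heisenberg.mul_s, Heisenberg.mul_x, Heisenberg.mul_y, inner_add_left,
      inner_sub_left, inner_add_right, inner_smul_left, real_inner_comm b.x a.y]
    simp
    ring
  · congr 1
    simp only [smul_add, Prod.mk.injEq]
    constructor <;> abel

theorem rep_one (h c : ℝ) (f : Fock n h c) : rep h c 1 f = f := by
  apply Subtype.ext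
  simp only [coe_rep]
  apply Lp.ext
  refine (coeFn_repLp h _ _).trans (Filter.Eventually.of_forall fun w => ?_)
  simp [repFun, repPhase]

/-- The centre acts by scalars; this is what turns integration over `s` into a Fourier transform at
frequency `h`. -/
theorem rep_eq_smul_rep_lift (h c : ℝ) (g : Heisenberg n) (f : Fock n h c) :
    rep h c g f = cexp ((-(2 * Real.pi * h * g.s) : ℝ) * I) •
      rep h c (Heisenberg.lift (g.x, g.y)) f := by
  apply Subtype.ext
  simp only [Submodule.coe_smul, coe_rep]
  apply Lp.ext
  filter_upwards [coeFn_repLp h g f, coeFn_repLp h (Heisenberg.lift (g.x, g.y)) f,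
    Lp.coeFn_smul (cexp ((-(2 * Real.pi * h * g.s) : ℝ) * I))
      (repLp h (Heisenberg.lift (g.x, g.y)) (f : Lp ℂ 2 (volume : Measure (Phase n))))]
    with w h1 h2 h3
  rw [h1, h3, Pi.smul_apply, h2]
  simp only [repFun, Heisenberg.lift, smul_eq_mul]
  rw [← mul_assoc, ← Complex.exp_add, ← add_mul, ← ofReal_add]
  congr 5
  simp only [repPhase]
  ring

theorem inner_rep_rep (h c : ℝ) (g : Heisenberg n) (f f' : Fock n h c) :
    ⟪rep h c g f, rep h c g f'⟫_ℂ = ⟪f, f'⟫_ℂ :=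
  (repLp h g).inner_map_map f f'

theorem inner_rep_left (h c : ℝ) (g : Heisenberg n) (f f' : Fock n h c) :
    ⟪rep h c g f, f'⟫_ℂ = ⟪f, rep h c g⁻¹ f'⟫_ℂ := by
  have h1 : rep h c g (rep h c g⁻¹ f') = f' := by rw [← rep_mul, mul_inv_cancel, rep_one]
  have h2 := inner_rep_rep h c g f (rep h c g⁻¹ f')
  rwa [h1] at h2

theorem fockInner_eq_inner {h c : ℝ} (f₁ f₂ : Fock n h c) :
    fockInner f₁ f₂ = ((4 / h : ℝ) : ℂ) ^ n * ⟪f₂, f₁⟫_ℂ := by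
  rw [Submodule.coe_inner, L2.inner_def]
  simp [fockInner, RCLike.inner_apply]

theorem fockInner_smul_left {h c : ℝ} (a : ℂ) (f₁ f₂ : Fock n h c) :
    fockInner (a • f₁) f₂ = a * fockInner f₁ f₂ := by
  have h1 : ⟪f₂, a • f₁⟫_ℂ = a * ⟪f₂, f₁⟫_ℂ := inner_smul_right (𝕜 := ℂ) f₂ f₁ a
  rw [fockInner_eq_inner, fockInner_eq_inner, h1]
  ring

theorem fockInner_rep_right {h c : ℝ} (g : Heisenberg n) (f₁ f₂ : Fock n h c) :
    fockInner f₁ (rep h c g f₂) = fockInner (rep h c g⁻¹ f₁) f₂ := by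
  rw [fockInner_eq_inner, fockInner_eq_inner, inner_rep_left]

/-- The Gaussian `exp(-(πh/2)(c|x|² + c⁻¹|y|²))`. -/
def coherentGaussian (h c : ℝ) (u : Phase n) : ℝ :=
  Real.exp (-(Real.pi * h / 2) * (c * ‖u.1‖ ^ 2 + c⁻¹ * ‖u.2‖ ^ 2))

/-- The Gaussian integral `∫ e^{-2πi q·x} e^{-a(|q + b y|² + |q|²)} dq`. -/
theorem integral_gaussian_shift {a : ℝ} (ha : 0 < a) (b : ℝ) (x y : RSpace n) :
    ∫ q : RSpace n, cexp ((-(2 * Real.pi) * ⟪q, x⟫_ℝ : ℝ) * I) *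
        (Real.exp (-a * (‖q + b • y‖ ^ 2 + ‖q‖ ^ 2)) : ℝ) =
      cexp ((Real.pi * b * ⟪y, x⟫_ℝ : ℝ) * I) *
        ((Real.pi / (2 * a) : ℝ) ^ (n / 2 : ℂ) *
          (Real.exp (-(a * b ^ 2 / 2) * ‖y‖ ^ 2 - Real.pi ^ 2 / (2 * a) * ‖x‖ ^ 2) : ℝ)) := by
  have key := GaussianFourier.integral_cexp_neg_mul_sq_norm_add (V := RSpace n)
    (b := ((2 * a : ℝ) : ℂ)) (by simpa using ha) (-(2 * Real.pi) * I) x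
  -- Recentring at the midpoint of `0` and `-b y`: by the parallelogram law the quadratic form
  -- becomes `2|q|² + (b²/2)|y|²`, and the character contributes the phase `e^{πi b y·x}`.
  rw [← integral_sub_right_eq_self (μ := volume) _ ((b / 2) • y)]
  have h1 : ∀ q : RSpace n, cexp ((-(2 * Real.pi) * ⟪q - (b / 2) • y, x⟫_ℝ : ℝ) * I) *
        (Real.exp (-a * (‖q - (b / 2) • y + b • y‖ ^ 2 + ‖q - (b / 2) • y‖ ^ 2)) : ℝ) =
      cexp ((Real.pi * b * ⟪y, x⟫_ℝ : ℝ) * I) * (Real.exp (-(a * b ^ 2 / 2) * ‖y‖ ^ 2) : ℝ) *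
        cexp (-((2 * a : ℝ) : ℂ) * ‖q‖ ^ 2 + (-(2 * Real.pi) * I) * ⟪x, q⟫_ℝ) := by
    intro q
    have h2 : q - (b / 2) • y + b • y = q + (b / 2) • y := by
      rw [sub_add, ← sub_smul]; rw [show b / 2 - b = -(b / 2) by ring, neg_smul, sub_neg_eq_add]
    rw [h2, norm_add_sq_real, norm_sub_sq_real, norm_smul, inner_sub_left, inner_smul_left,
      real_inner_comm x q, ofReal_exp, ofReal_exp, ← Complex.exp_add, ← Complex.exp_add,
      ← Complex.exp_add, mul_pow, Real.norm_eq_abs, sq_abs]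
    congr 1
    simp
    ring
  simp only [h1]
  rw [integral_const_mul, key]
  have h3 : (-(2 * Real.pi) * I) ^ 2 * (‖x‖ : ℂ) ^ 2 / (4 * ((2 * a : ℝ) : ℂ)) =
      ((-(Real.pi ^ 2 / (2 * a) * ‖x‖ ^ 2) : ℝ) : ℂ) := by
    have : (a : ℂ) ≠ 0 := by exact_mod_cast ha.ne'
    push_cast
    rw [mul_pow, I_sq]
    field_simp
    ring
  rw [h3, sub_eq_add_neg, Real.exp_add]
  simp
  ring

/-- The integral factors into a `q`-integral and a `p`-integral, each given by
`integral_gaussian_shift`. Their phases cancel, and the factor `(4/h)ⁿ` in the inner product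
normalises the vacuum. -/
theorem fockInner_rep_vacuum {h c : ℝ} (hh : 0 < h) (hc : 0 < c) (u : Phase n) :
    fockInner (rep h c (Heisenberg.lift u) (vacuum hh hc)) (vacuum hh hc) =
      coherentGaussian h c u := by
  have hp := Real.pi_pos
  have h1 : ∀ᵐ w : Phase n,
      ((rep h c (Heisenberg.lift u) (vacuum hh hc) : Fock n h c) :
        Lp ℂ 2 (volume : Measure (Phase n))) w *
      (starRingEnd ℂ) (((vacuum hh hc : Fock n h c) : Lp ℂ 2 (volume : Measure (Phase n))) w) =
      (cexp ((-(2 * Real.pi) * ⟪w.1, u.1⟫_ℝ : ℝ) * I) *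
        (Real.exp (-(2 * Real.pi / h * c⁻¹) *
          (‖w.1 + (-(h / 2)) • u.2‖ ^ 2 + ‖w.1‖ ^ 2)) : ℝ)) *
      (cexp ((-(2 * Real.pi) * ⟪w.2, u.2⟫_ℝ : ℝ) * I) *
        (Real.exp (-(2 * Real.pi / h * c) *
          (‖w.2 + (h / 2) • u.1‖ ^ 2 + ‖w.2‖ ^ 2)) : ℝ)) := by
    have h2 := (memLp_vacuumFun (n := n) hh hc).coeFn_toLp
    have h3 := (coeFn_repLp h (Heisenberg.lift u) _).trans (repFun_congr h (Heisenberg.lift u) h2)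
    filter_upwards [h2, h3] with w h4 h5
    rw [coe_rep]
    simp only [vacuum]
    rw [h4, h5]
    simp only [repFun, vacuumFun, repPhase, Heisenberg.lift, conj_ofReal, neg_smul,
      ← sub_eq_add_neg]
    simp only [ofReal_exp]
    simp only [← Complex.exp_add]
    congr 1
    push_cast
    ring
  rw [fockInner, integral_congr_ae h1]
  have h6 := integral_prod_mul (μ := (volume : Measure (RSpace n)))
    (ν := (volume : Measure (RSpace n)))
    (fun q => cexp ((-(2 * Real.pi) * ⟪q, u.1⟫_ℝ : ℝ) * I) *
        (Real.exp (-(2 * Real.pi / h * c⁻¹) *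
          (‖q + (-(h / 2)) • u.2‖ ^ 2 + ‖q‖ ^ 2)) : ℝ))
    (fun p => cexp ((-(2 * Real.pi) * ⟪p, u.2⟫_ℝ : ℝ) * I) *
        (Real.exp (-(2 * Real.pi / h * c) *
          (‖p + (h / 2) • u.1‖ ^ 2 + ‖p‖ ^ 2)) : ℝ))
  rw [Measure.volume_eq_prod, h6, integral_gaussian_shift (by positivity),
    integral_gaussian_shift (by positivity)]
  -- The two bases are `hc/4` and `h/(4c)`, with product `(h/4)²`.
  have h7 : ((4 / h : ℝ) : ℂ) ^ n * (((Real.pi / (2 * (2 * Real.pi / h * c⁻¹)) : ℝ) ^ (n / 2 : ℂ)) *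
      ((Real.pi / (2 * (2 * Real.pi / h * c)) : ℝ) ^ (n / 2 : ℂ))) = 1 := by
    rw [← mul_cpow_ofReal_nonneg (by positivity) (by positivity), ← ofReal_mul]
    have h8 : Real.pi / (2 * (2 * Real.pi / h * c⁻¹)) * (Real.pi / (2 * (2 * Real.pi / h * c))) =
        (h / 4) ^ 2 := by
      field_simp; ring
    have h9 : (n / 2 : ℂ) = ((n / 2 : ℝ) : ℂ) := by push_cast; rfl
    rw [h8, h9, ← ofReal_cpow (by positivity), ← Real.rpow_natCast, ← Real.rpow_mul (by positivity),
      ← ofReal_pow, ← ofReal_mul]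
    norm_cast
    rw [show (2 : ℝ) * (n / 2) = n by ring, Real.rpow_natCast, ← mul_pow,
      show 4 / h * (h / 4) = 1 by field_simp, one_pow]
  -- The translations in `q` and `p` have opposite signs, so the two midpoint phases are inverse to
  -- each other.
  have h10 : cexp ((Real.pi * (-(h / 2)) * ⟪u.2, u.1⟫_ℝ : ℝ) * I) *
      cexp ((Real.pi * (h / 2) * ⟪u.1, u.2⟫_ℝ : ℝ) * I) = 1 := by
    rw [← Complex.exp_add, real_inner_comm, ← add_mul, ← ofReal_add]
    simp
  have h11 : Real.exp (-(2 * Real.pi / h * c⁻¹ * (-(h / 2)) ^ 2 / 2) * ‖u.2‖ ^ 2 -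
        Real.pi ^ 2 / (2 * (2 * Real.pi / h * c⁻¹)) * ‖u.1‖ ^ 2) *
      Real.exp (-(2 * Real.pi / h * c * (h / 2) ^ 2 / 2) * ‖u.1‖ ^ 2 -
        Real.pi ^ 2 / (2 * (2 * Real.pi / h * c)) * ‖u.2‖ ^ 2) = coherentGaussian h c u := by
    rw [coherentGaussian, ← Real.exp_add]
    congr 1
    field_simp
    ring
  have h12 : ∀ N E₁ E₂ A₁ A₂ B₁ B₂ G : ℂ, N * (B₁ * B₂) = 1 → E₁ * E₂ = 1 → A₁ * A₂ = G →
      N * ((E₁ * (B₁ * A₁)) * (E₂ * (B₂ * A₂))) = G := by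
    intro N E₁ E₂ A₁ A₂ B₁ B₂ G e₁ e₂ e₃
    linear_combination (A₁ * A₂ * E₁ * E₂) * e₁ + A₁ * A₂ * e₂ + e₃
  exact h12 _ _ _ _ _ _ _ _ h7 h10 (by rw [← ofReal_mul, h11])

/-- The matrix coefficients of `ρ_h((0,z)⁻¹) ρ_h(g)` at coherent states. -/
theorem fockInner_coherent {h c : ℝ} (hh : 0 < h) (hc : 0 < c) (z z' : Phase n)
    (g : Heisenberg n) :
    fockInner (rep h c (Heisenberg.lift z)⁻¹ (rep h c g (coherent hh hc z')))
      (coherent hh hc z') =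
      cexp ((-(2 * Real.pi * h * (g.s - (1 / 2) * sympForm z (g.x, g.y) -
        sympForm z' ((g.x, g.y) - z))) : ℝ) * I) * coherentGaussian h c ((g.x, g.y) - z) := by
  -- By unitarity the coefficient at `v_{z'}` is the vacuum coefficient of this conjugate.
  -- Conjugation by `(0,z')` fixes the `(x,y)` part and changes only the central coordinate,
  -- linearly in `z'`.
  obtain ⟨a, ha⟩ : ∃ a : Heisenberg n, a = (Heisenberg.lift z')⁻¹ * ((Heisenberg.lift z)⁻¹ *
    (g * Heisenberg.lift z')) := ⟨_, rfl⟩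
  have h0 : rep h c a (vacuum hh hc) = rep h c (Heisenberg.lift z')⁻¹
      (rep h c (Heisenberg.lift z)⁻¹ (rep h c g (coherent hh hc z'))) := by
    rw [ha, rep_mul h c (Heisenberg.lift z')⁻¹, rep_mul h c (Heisenberg.lift z)⁻¹,
      rep_mul h c g]
    rfl
  have h1 : fockInner (rep h c (Heisenberg.lift z)⁻¹ (rep h c g (coherent hh hc z')))
      (coherent hh hc z') = fockInner (rep h c a (vacuum hh hc)) (vacuum hh hc) :=
    (fockInner_rep_right (Heisenberg.lift z') _ _).trans
      (congrArg (fun f => fockInner f (vacuum hh hc)) h0.symm)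
  have h2 : (a.x, a.y) = (g.x, g.y) - z := by
    simp only [ha, Heisenberg.mul_x, Heisenberg.mul_y, Heisenberg.inv_x, Heisenberg.inv_y,
      Heisenberg.lift]
    ext1
    · simp; abel
    · simp; abel
  have h3 : a.s = g.s - (1 / 2) * sympForm z (g.x, g.y) - sympForm z' ((g.x, g.y) - z) := by
    simp only [ha, Heisenberg.mul_s, Heisenberg.inv_s, Heisenberg.mul_x, Heisenberg.mul_y,
      Heisenberg.inv_x, Heisenberg.inv_y, Heisenberg.lift, sympForm, inner_add_left,
      inner_add_right, inner_sub_left, inner_sub_right, inner_neg_left, inner_neg_right,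
      Prod.fst_sub, Prod.snd_sub]
    simp only [real_inner_comm z.2 z'.1, real_inner_comm z'.2 g.x]
    ring
  have h4 : ∀ s u, a.s = s → (a.x, a.y) = u → rep h c a (vacuum hh hc) =
      cexp ((-(2 * Real.pi * h * s) : ℝ) * I) • rep h c (Heisenberg.lift u) (vacuum hh hc) := by
    rintro _ _ rfl rfl
    exact rep_eq_smul_rep_lift h c a (vacuum hh hc)
  exact h1.trans ((congrArg (fun f => fockInner f (vacuum hh hc)) (h4 _ _ h3 h2)).trans
    ((fockInner_smul_left _ _ _).trans
      (congrArg _ (fockInner_rep_vacuum hh hc ((g.x, g.y) - z)))))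

end MatrixCoefficients

/-! ### Integration over the group and the Fourier transform in the central variable. -/

section CentralFourier

variable {n : ℕ}

namespace Heisenberg

theorem measurable_coords_symm : Measurable (coords (n := n)).symm :=
  measurable_comap_iff.2 measurable_id

/-- Exponential coordinates as a measurable equivalence. -/
def measurableEquivCoords : Heisenberg n ≃ᵐ ℝ × RSpace n × RSpace n where
  toEquiv := coords
  measurable_toFun := measurable_coords
  measurable_invFun := measurable_coords_symm

theorem measurePreserving_coords_symm :
    MeasurePreserving (measurableEquivCoords (n := n)).symm volume volume :=
  ⟨measurable_coords_symm, rfl⟩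

theorem integrable_iff_comp_coords_symm {E : Type*} [NormedAddCommGroup E]
    {F : Heisenberg n → E} :
    Integrable F ↔ Integrable fun v : ℝ × Phase n => F ⟨v.1, v.2.1, v.2.2⟩ :=
  (measurePreserving_coords_symm.integrable_comp_emb
    measurableEquivCoords.symm.measurableEmbedding).symm

theorem integral_eq_integral_integral {E : Type*} [NormedAddCommGroup E] [NormedSpace ℝ E]
    [CompleteSpace E] {F : Heisenberg n → E} (hF : Integrable F) :
    ∫ g, F g = ∫ w : Phase n, ∫ s : ℝ, F ⟨s, w.1, w.2⟩ := by
  rw [← measurePreserving_coords_symm.integral_comp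
    measurableEquivCoords.symm.measurableEmbedding]
  exact integral_prod_symm _ (integrable_iff_comp_coords_symm.1 hF)

theorem integrable_integral {E : Type*} [NormedAddCommGroup E] [NormedSpace ℝ E]
    {F : Heisenberg n → E} (hF : Integrable F) :
    Integrable fun w : Phase n => ∫ s : ℝ, F ⟨s, w.1, w.2⟩ :=
  (integrable_iff_comp_coords_symm.1 hF).integral_prod_right

theorem measurable_s : Measurable (Heisenberg.s (n := n)) :=
  measurable_fst.comp measurable_coords

theorem measurable_proj : Measurable fun g : Heisenberg n => ((g.x, g.y) : Phase n) :=
  measurable_snd.comp measurable_coords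

end Heisenberg

/-- The Fourier transform `b(x,y) = ∫ k(s,x,y) e^{-2πihs} ds` in the central variable. -/
def centralFourier (h : ℝ) (k : Heisenberg n → ℂ) (w : Phase n) : ℂ :=
  ∫ s : ℝ, cexp ((-(2 * Real.pi * h * s) : ℝ) * I) * k ⟨s, w.1, w.2⟩

theorem integrable_centralPhase_mul (h : ℝ) {k : Heisenberg n → ℂ} (hk : Integrable k) :
    Integrable fun g : Heisenberg n => cexp ((-(2 * Real.pi * h * g.s) : ℝ) * I) * k g := by
  refine hk.bdd_mul (c := 1) ?_ (Filter.Eventually.of_forall fun g =>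
    (Complex.norm_exp_ofReal_mul_I _).le)
  have := Heisenberg.measurable_s (n := n)
  exact Measurable.aestronglyMeasurable (by fun_prop)

theorem integrable_centralFourier (h : ℝ) {k : Heisenberg n → ℂ} (hk : Integrable k) :
    Integrable (centralFourier h k) :=
  Heisenberg.integrable_integral (integrable_centralPhase_mul h hk)

/-- Fubini, integrating over `s` first. The vector-valued form serves twice: for scalar coherent
coefficients and for the vectors `ρ_h(0,w) f`. -/
theorem integral_centralPhase_smul {E : Type*} [NormedAddCommGroup E] [NormedSpace ℂ E]
    [CompleteSpace E] (h : ℝ) {k : Heisenberg n → ℂ} (hk : Integrable k) {Φ : Phase n → E}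
    (hΦ : Continuous Φ) {C : ℝ} (hC : ∀ w, ‖Φ w‖ ≤ C) :
    ∫ g : Heisenberg n, (cexp ((-(2 * Real.pi * h * g.s) : ℝ) * I) * k g) • Φ (g.x, g.y) =
      ∫ w, centralFourier h k w • Φ w := by
  rw [Heisenberg.integral_eq_integral_integral]
  · refine integral_congr_ae (Filter.Eventually.of_forall fun w => ?_)
    exact integral_smul_const _ (Φ w)
  · refine (integrable_centralPhase_mul h hk).smul_bdd C ?_
      (Filter.Eventually.of_forall fun g => hC _)
    exact (hΦ.stronglyMeasurable.comp_measurable Heisenberg.measurable_proj).aestronglyMeasurable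

end CentralFourier

/-! ### The trace as a Fourier integral, and the inversion of the wavelet transform. -/

section Trace

variable {n : ℕ}

theorem continuous_coherentGaussian (h c : ℝ) : Continuous (coherentGaussian (n := n) h c) := by
  unfold coherentGaussian; fun_prop

theorem coherentGaussian_pos (h c : ℝ) (u : Phase n) : 0 < coherentGaussian h c u :=
  Real.exp_pos _

theorem coherentGaussian_le_one {h c : ℝ} (hh : 0 < h) (hc : 0 < c) (u : Phase n) :
    coherentGaussian h c u ≤ 1 := by
  have := Real.pi_pos
  refine Real.exp_le_one_iff.2 ?_
  rw [neg_mul]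
  exact neg_nonpos.2 (by positivity)

theorem continuous_sympForm (z : Phase n) : Continuous (sympForm z) := by
  unfold sympForm; fun_prop

/-- `u ↦ b(z+u) e^{πihω(z,u)} G(u)`, whose Fourier transform gives the matrix coefficients. -/
def twistedGaussian (h c : ℝ) (b : Phase n → ℂ) (z u : Phase n) : ℂ :=
  b (z + u) * (cexp ((Real.pi * h * sympForm z u : ℝ) * I) * coherentGaussian h c u)

theorem continuous_twist (h c : ℝ) (z : Phase n) : Continuous fun u : Phase n =>
    cexp ((Real.pi * h * sympForm z u : ℝ) * I) * (coherentGaussian h c u : ℂ) := by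
  have h1 := continuous_sympForm z
  have h2 := continuous_coherentGaussian (n := n) h c
  fun_prop

theorem norm_twist_le {h c : ℝ} (hh : 0 < h) (hc : 0 < c) (z u : Phase n) :
    ‖cexp ((Real.pi * h * sympForm z u : ℝ) * I) * (coherentGaussian h c u : ℂ)‖ ≤ 1 := by
  rw [norm_mul, Complex.norm_exp_ofReal_mul_I, one_mul, Complex.norm_real, Real.norm_eq_abs,
    abs_of_pos (coherentGaussian_pos h c u)]
  exact coherentGaussian_le_one hh hc u

theorem integrable_twistedGaussian {h c : ℝ} (hh : 0 < h) (hc : 0 < c) {b : Phase n → ℂ}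
    (hb : Integrable b) (z : Phase n) : Integrable (twistedGaussian h c b z) :=
  (hb.comp_add_left z).mul_bdd (c := 1) (continuous_twist h c z).aestronglyMeasurable
    (Filter.Eventually.of_forall fun u => norm_twist_le hh hc z u)

theorem repKernel_apply {h c κ : ℝ} {k : Heisenberg n → ℂ} (hk : Integrable k) (f : Fock n h c) :
    repKernel h c κ k hk f = (κ : ℂ) ^ (n + 1) • ∫ g, k g • rep h c g f := rfl

theorem inverseWavelet_apply {h c : ℝ} {a : Phase n → ℂ} (ha : Integrable a) (f : Fock n h c) :
    inverseWavelet h c a ha f = (h : ℂ) ^ n • ∫ z, a z • rep h c (Heisenberg.lift z) f := rfl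

theorem integrable_smul_rep {h c : ℝ} {k : Heisenberg n → ℂ} (hk : Integrable k)
    (f : Fock n h c) : Integrable fun g => k g • rep h c g f :=
  hk.smul_bdd ‖f‖ (aestronglyMeasurable_rep h c f)
    (Filter.Eventually.of_forall fun g => (norm_rep h c g f).le)

/-- The functional `f ↦ ⟨U f, v⟩`. -/
def fockFunctional {h c : ℝ} (U : Fock n h c →L[ℂ] Fock n h c) (v : Fock n h c) :
    Fock n h c →L[ℂ] ℂ :=
  (((4 / h : ℝ) : ℂ) ^ n) • (innerSL ℂ v).comp U

theorem fockFunctional_apply {h c : ℝ} (U : Fock n h c →L[ℂ] Fock n h c) (v f : Fock n h c) :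
    fockFunctional U v f = fockInner (U f) v :=
  (fockInner_eq_inner (U f) v).symm

theorem sympForm_add_right (z u w : Phase n) : sympForm z (u + w) = sympForm z u + sympForm z w := by
  simp only [sympForm, Prod.fst_add, Prod.snd_add, inner_add_left, inner_add_right]
  ring

theorem sympForm_self (z : Phase n) : sympForm z z = 0 := by
  simp [sympForm]

theorem inner_sympFreq (h : ℝ) (z u : Phase n) :
    ⟪u.1, (sympFreq h z).1⟫_ℝ + ⟪u.2, (sympFreq h z).2⟫_ℝ = -(h * sympForm z u) := by
  simp only [sympFreq, sympForm, Prod.smul_fst, Prod.smul_snd, inner_smul_right, inner_neg_right,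
    real_inner_comm u.2 z.1]
  ring

/-- After the central integration, substitute `w = z + u`. Since `ω(z,z) = 0`, the phase splits into
the twist `e^{πihω(z,u)}` and `e^{2πihω(z',u)}`; the latter is the Fourier character at `sympFreq h
z'`. -/
theorem integral_mul_fockInner_coherent {h c : ℝ} (hh : 0 < h) (hc : 0 < c)
    {k : Heisenberg n → ℂ} (hk : Integrable k) (z z' : Phase n) :
    ∫ g, k g * fockInner (rep h c (Heisenberg.lift z)⁻¹ (rep h c g (coherent hh hc z')))
      (coherent hh hc z') =
    phaseFourier (twistedGaussian h c (centralFourier h k) z) (sympFreq h z') := by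
  -- The coherent coefficient with its central character removed: a bounded continuous function of
  -- `w = (g.x, g.y)`.
  let Φ : Phase n → ℂ := fun w =>
    cexp ((2 * Real.pi * h * ((1 / 2) * sympForm z w + sympForm z' (w - z)) : ℝ) * I) *
      coherentGaussian h c (w - z)
  have hΦ : Continuous Φ := by
    have h1 := continuous_sympForm z
    have h2 := continuous_sympForm z'
    have h3 := continuous_coherentGaussian (n := n) h c
    fun_prop
  have hΦ1 : ∀ w, ‖Φ w‖ ≤ 1 := fun w => by
    simp only [Φ]
    rw [norm_mul, Complex.norm_exp_ofReal_mul_I, one_mul, Complex.norm_real, Real.norm_eq_abs,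
      abs_of_pos (coherentGaussian_pos h c _)]
    exact coherentGaussian_le_one hh hc _
  have h1 : ∀ g : Heisenberg n, k g * fockInner (rep h c (Heisenberg.lift z)⁻¹
      (rep h c g (coherent hh hc z'))) (coherent hh hc z') =
      (cexp ((-(2 * Real.pi * h * g.s) : ℝ) * I) * k g) • Φ (g.x, g.y) := by
    intro g
    have h2 : cexp ((-(2 * Real.pi * h * (g.s - (1 / 2) * sympForm z (g.x, g.y) -
        sympForm z' ((g.x, g.y) - z))) : ℝ) * I) = cexp ((-(2 * Real.pi * h * g.s) : ℝ) * I) *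
        cexp ((2 * Real.pi * h * ((1 / 2) * sympForm z (g.x, g.y) +
          sympForm z' ((g.x, g.y) - z)) : ℝ) * I) := by
      rw [← Complex.exp_add, ← add_mul, ← ofReal_add]
      congr 3
      ring
    rw [fockInner_coherent, h2, smul_eq_mul]
    simp only [Φ]
    ring
  rw [integral_congr_ae (Filter.Eventually.of_forall h1), integral_centralPhase_smul h hk hΦ hΦ1,
    ← integral_add_left_eq_self _ z, phaseFourier]
  refine integral_congr_ae (Filter.Eventually.of_forall fun u => ?_)
  simp only [twistedGaussian, Φ, inner_sympFreq, add_sub_cancel_left, sympForm_add_right,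
    sympForm_self, zero_add, smul_eq_mul]
  have h3 : cexp ((2 * Real.pi * h * ((1 / 2) * sympForm z u + sympForm z' u) : ℝ) * I) =
      cexp ((-(2 * Real.pi) * -(h * sympForm z' u) : ℝ) * I) *
        cexp ((Real.pi * h * sympForm z u : ℝ) * I) := by
    rw [← Complex.exp_add, ← add_mul, ← ofReal_add]
    congr 3
    ring
  rw [h3]
  ring

/-- The diagonal coherent matrix coefficients of `ρ_h((0,z)⁻¹) ρ_h(k)`. -/
theorem fockInner_shiftOperator_repKernel {h c κ : ℝ} (hh : 0 < h) (hc : 0 < c)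
    {k : Heisenberg n → ℂ} (hk : Integrable k) (z z' : Phase n) :
    fockInner (shiftOperator (repKernel h c κ k hk) z (coherent hh hc z')) (coherent hh hc z') =
      (κ : ℂ) ^ (n + 1) *
        phaseFourier (twistedGaussian h c (centralFourier h k) z) (sympFreq h z') := by
  have h1 := (fockFunctional (rep h c (Heisenberg.lift z)⁻¹)
    (coherent hh hc z')).integral_comp_comm (integrable_smul_rep hk (coherent hh hc z'))
  have h2 : fockInner (shiftOperator (repKernel h c κ k hk) z (coherent hh hc z'))
      (coherent hh hc z') = fockFunctional (rep h c (Heisenberg.lift z)⁻¹) (coherent hh hc z')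
        (repKernel h c κ k hk (coherent hh hc z')) := (fockFunctional_apply _ _ _).symm
  rw [h2, repKernel_apply, map_smul, ← h1, smul_eq_mul, ← integral_mul_fockInner_coherent hh hc hk]
  congr 2
  funext g
  rw [map_smul, smul_eq_mul, fockFunctional_apply]

/-- Neither the nonzero constant `κ^{n+1}` nor the invertible linear substitution `z' ↦ sympFreq h
z'` affects integrability. -/
theorem hasCoherentTrace_iff {h c κ : ℝ} (hh : 0 < h) (hc : 0 < c) (hκ : 0 < κ)
    {k : Heisenberg n → ℂ} (hk : Integrable k) (z : Phase n) :
    HasCoherentTrace hh hc (shiftOperator (repKernel h c κ k hk) z) ↔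
      Integrable (phaseFourier (twistedGaussian h c (centralFourier h k) z)) := by
  have hκ' : IsUnit ((κ : ℂ) ^ (n + 1)) :=
    (pow_ne_zero _ (by exact_mod_cast hκ.ne')).isUnit
  simp only [HasCoherentTrace, fockInner_shiftOperator_repKernel]
  rw [integrable_const_mul_iff hκ', integrable_comp_sympFreq hh]

/-- The power `h^{-n}` combines `hⁿ` from the trace with the Jacobian factor `h^{-2n}`. As an
identity of Bochner integrals it needs no convergence. -/
theorem reducedWavelet_repKernel {h c κ : ℝ} (hh : 0 < h) (hc : 0 < c)
    {k : Heisenberg n → ℂ} (hk : Integrable k) (z : Phase n) :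
    reducedWavelet hh hc (repKernel h c κ k hk) z = ((h : ℂ) ^ n)⁻¹ * (κ : ℂ) ^ (n + 1) *
      ∫ ξ, phaseFourier (twistedGaussian h c (centralFourier h k) z) ξ := by
  have hh' : (h : ℂ) ≠ 0 := by exact_mod_cast hh.ne'
  simp only [reducedWavelet, coherentTrace, fockInner_shiftOperator_repKernel]
  rw [integral_const_mul, integral_comp_sympFreq hh, two_mul, pow_add]
  field_simp
  ring

/-- One `z` suffices for all of `ℝ²ⁿ`: the twist is continuous and vanishes nowhere, so it can be
divided out of the continuous representative before translating back by `z`. -/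
theorem exists_continuous_ae_eq_of_twistedGaussian {h c : ℝ} (hh : 0 < h) (hc : 0 < c)
    {b : Phase n → ℂ} (hb : Integrable b) (z : Phase n)
    (hz : Integrable (phaseFourier (twistedGaussian h c b z))) :
    ∃ b' : Phase n → ℂ, Continuous b' ∧ b =ᵐ[volume] b' := by
  obtain ⟨g, hg, hbg⟩ := exists_continuous_ae_eq (integrable_twistedGaussian hh hc hb z) hz
  have hne : ∀ u : Phase n, cexp ((Real.pi * h * sympForm z u : ℝ) * I) *
      (coherentGaussian h c u : ℂ) ≠ 0 := fun u =>
    mul_ne_zero (Complex.exp_ne_zero _) (by exact_mod_cast (coherentGaussian_pos h c u).ne')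
  have hcont : Continuous fun u => g u / (cexp ((Real.pi * h * sympForm z u : ℝ) * I) *
      (coherentGaussian h c u : ℂ)) := hg.div (continuous_twist h c z) hne
  refine ⟨_, hcont.comp (continuous_sub_right z), ?_⟩
  filter_upwards [(measurePreserving_sub_right volume z).quasiMeasurePreserving.ae hbg] with w hw
  simp only [Function.comp_apply, ← hw, twistedGaussian, add_sub_cancel]
  rw [mul_div_assoc, div_self (hne _), mul_one]

/-- Inversion at `u = 0`, where the twist and the Gaussian both equal `1`, reads off `b(z)`. The
exceptional null set collects the `z` without a trace and those where `b` differs from its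
continuous representative. -/
theorem reducedWavelet_ae_eq {h c κ : ℝ} (hh : 0 < h) (hc : 0 < c) (hκ : 0 < κ)
    {k : Heisenberg n → ℂ} (hk : Integrable k)
    (htr : ∀ᵐ z : Phase n, HasCoherentTrace hh hc (shiftOperator (repKernel h c κ k hk) z)) :
    reducedWavelet hh hc (repKernel h c κ k hk) =ᵐ[volume]
      fun z => ((h : ℂ) ^ n)⁻¹ * (κ : ℂ) ^ (n + 1) * centralFourier h k z := by
  simp only [hasCoherentTrace_iff hh hc hκ] at htr
  have hb := integrable_centralFourier h hk
  obtain ⟨z₀, hz₀⟩ := htr.exists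
  obtain ⟨b', hb'c, hbb'⟩ := exists_continuous_ae_eq_of_twistedGaussian hh hc hb z₀ hz₀
  filter_upwards [htr, hbb'] with z hz hzb
  -- Replacing `b` by `b'` leaves the Fourier transform unchanged and makes the function continuous
  -- at `0`, as pointwise inversion requires.
  have h1 : twistedGaussian h c (centralFourier h k) z =ᵐ[volume] twistedGaussian h c b' z := by
    filter_upwards [(measurePreserving_add_left volume z).quasiMeasurePreserving.ae hbb']
      with u hu
    simp only [twistedGaussian, hu]
  have h2 : Continuous (twistedGaussian h c b' z) :=
    (hb'c.comp (continuous_const.add continuous_id)).mul (continuous_twist h c z)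
  rw [phaseFourier_congr h1] at hz
  rw [reducedWavelet_repKernel, phaseFourier_congr h1, hzb, integral_phaseFourier
    ((integrable_twistedGaussian hh hc hb z).congr h1) hz h2.continuousAt]
  simp [twistedGaussian, sympForm, coherentGaussian]

theorem continuous_rep_lift (h c : ℝ) (f : Fock n h c) :
    Continuous fun z : Phase n => rep h c (Heisenberg.lift z) f := by
  have h1 : Continuous fun z : Phase n => ((0 : ℝ), z.1, z.2) := by fun_prop
  have h2 := (continuous_rep h c f).comp h1
  exact h2

/-- The operator of a kernel sees only its central frequency `h`: the centre acts by scalars, so the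
`s`-integral falls on `k` alone. -/
theorem integral_centralFourier_smul_rep {h c : ℝ} {k : Heisenberg n → ℂ} (hk : Integrable k)
    (f : Fock n h c) :
    ∫ z, centralFourier h k z • rep h c (Heisenberg.lift z) f = ∫ g, k g • rep h c g f := by
  refine (integral_centralPhase_smul h hk (continuous_rep_lift h c f)
    (fun z => (norm_rep h c _ f).le)).symm.trans ?_
  refine integral_congr_ae (Filter.Eventually.of_forall fun g => ?_)
  have h1 : ∀ (a e : ℂ) (v : Fock n h c), (e * a) • v = a • e • v := fun a e v => by
    rw [smul_smul, mul_comm]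
  exact (h1 _ _ _).trans (congrArg (k g • ·) (rep_eq_smul_rep_lift h c g f)).symm

/-- The transform is a.e. a multiple of the integrable `b`; the factor `hⁿ` of the inverse transform
cancels `h^{-n}`, leaving `κ^{n+1} ∫ b(w) ρ_h(0,w) dw`. -/
theorem inverseWavelet_reducedWavelet {h c κ : ℝ} (hh : 0 < h) (hc : 0 < c) (hκ : 0 < κ)
    {k : Heisenberg n → ℂ} (hk : Integrable k)
    (htr : ∀ᵐ z : Phase n, HasCoherentTrace hh hc (shiftOperator (repKernel h c κ k hk) z)) :
    ∃ ha : Integrable (reducedWavelet hh hc (repKernel h c κ k hk)),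
      inverseWavelet h c (reducedWavelet hh hc (repKernel h c κ k hk)) ha =
        repKernel h c κ k hk := by
  have hae := reducedWavelet_ae_eq hh hc hκ hk htr
  refine ⟨((integrable_centralFourier h hk).const_mul _).congr hae.symm, ?_⟩
  have hh' : (h : ℂ) ^ n ≠ 0 := pow_ne_zero _ (by exact_mod_cast hh.ne')
  refine ContinuousLinearMap.ext fun f => ?_
  have h1 : ∫ z, reducedWavelet hh hc (repKernel h c κ k hk) z • rep h c (Heisenberg.lift z) f =
      (((h : ℂ) ^ n)⁻¹ * (κ : ℂ) ^ (n + 1)) • ∫ g, k g • rep h c g f := by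
    rw [← integral_centralFourier_smul_rep hk f, ← integral_smul]
    refine integral_congr_ae (hae.mono fun z hz => ?_)
    exact (congrArg (· • rep h c (Heisenberg.lift z) f) hz).trans (mul_smul _ _ _)
  rw [inverseWavelet_apply, h1, repKernel_apply]
  have h2 : ∀ (a b : ℂ) (v : Fock n h c), a ≠ 0 → a • (a⁻¹ * b) • v = b • v := by
    intro a b v ha
    rw [smul_smul, mul_inv_cancel_left₀ ha]
  exact h2 _ _ _ hh'

end Trace

/-! ### Existence of the trace for Schwartz kernels. -/

section Schwartz

/-- The function `e^{-t}` is not of temperate growth on `ℝ`, but it is on `[0,∞)`, which contains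
the range of `Q`. -/
theorem Function.HasTemperateGrowth.exp_neg {D : Type*} [NormedAddCommGroup D] [NormedSpace ℝ D]
    {Q : D → ℝ} (hQ : Q.HasTemperateGrowth) (hpos : ∀ v, 0 ≤ Q v) :
    (fun v => Real.exp (-Q v)).HasTemperateGrowth := by
  have hd : ContDiff ℝ ∞ (fun t : ℝ => Real.exp (-1 * t)) := by fun_prop
  have h1 := hQ.comp' (g := fun t : ℝ => Real.exp (-1 * t)) (t := Set.Ici 0)
    (by rintro _ ⟨v, rfl⟩; exact hpos v) (uniqueDiffOn_Ici 0) hd.contDiffOn ?_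
  · simpa [Function.comp_def] using h1
  -- Growth exponent `0` and constant `1`: every derivative is `±e^{-x}`, bounded by `1` for `x ≥
  -- 0`.
  · refine fun N => ⟨0, 1, zero_le_one, fun m _ x hx => ?_⟩
    rw [iteratedFDerivWithin_eq_iteratedFDeriv (uniqueDiffOn_Ici 0)
      (hd.contDiffAt.of_le (by exact_mod_cast le_top)) hx, norm_iteratedFDeriv_eq_norm_iteratedDeriv,
      iteratedDeriv_exp_const_mul]
    have h2 : Real.exp (-x) ≤ 1 := Real.exp_le_one_iff.2 (neg_nonpos.2 hx)
    simpa using h2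

/-- Composition of a Schwartz function with the affine map `v ↦ a + L v`. -/
def SchwartzMap.compAffine {D E : Type*} [NormedAddCommGroup D] [NormedSpace ℝ D]
    [NormedAddCommGroup E] [NormedSpace ℝ E] (φ : SchwartzMap E ℂ) (L : D →L[ℝ] E) {K : NNReal}
    (hL : AntilipschitzWith K L) (a : E) : SchwartzMap D ℂ :=
  SchwartzMap.compCLMOfAntilipschitz ℂ (g := fun v => a + L v) (K := K) (by fun_prop)
    (fun v w => by simpa using hL v w) φ

theorem SchwartzMap.compAffine_apply {D E : Type*} [NormedAddCommGroup D] [NormedSpace ℝ D]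
    [NormedAddCommGroup E] [NormedSpace ℝ E] (φ : SchwartzMap E ℂ) (L : D →L[ℝ] E) {K : NNReal}
    (hL : AntilipschitzWith K L) (a : E) (v : D) : φ.compAffine L hL a v = φ (a + L v) := rfl

variable {n : ℕ}

/-- `ℝ × ℝ²ⁿ` with its Euclidean norm. -/
abbrev CentralPhase (n : ℕ) : Type := WithLp 2 (ℝ × WithLp 2 (Phase n))

/-- The coordinates of `CentralPhase n`. -/
def centralPhaseCoords (n : ℕ) : CentralPhase n ≃L[ℝ] ℝ × Phase n :=
  (WithLp.prodContinuousLinearEquiv 2 ℝ ℝ (WithLp 2 (Phase n))).trans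
    ((ContinuousLinearEquiv.refl ℝ ℝ).prodCongr
      (WithLp.prodContinuousLinearEquiv 2 ℝ (RSpace n) (RSpace n)))

theorem centralPhaseCoords_apply (v : CentralPhase n) :
    centralPhaseCoords n v = (v.fst, v.snd.ofLp) := rfl

/-- An injective affine map from a finite-dimensional space is antilipschitz, so the restriction to
a slice is again Schwartz. -/
theorem integrable_slice (f : SchwartzMap (CentralPhase n) ℂ) (s : ℝ) (η : Phase n) :
    Integrable fun ξ : Phase n => f (WithLp.toLp 2 (s, WithLp.toLp 2 (ξ + η))) := by
  let L : Phase n →L[ℝ] CentralPhase n :=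
    (centralPhaseCoords n).symm.toContinuousLinearMap.comp
      (ContinuousLinearMap.inr ℝ ℝ (Phase n))
  have hL : Function.Injective L := (centralPhaseCoords n).symm.injective.comp
    (fun x y hxy => by simpa using hxy)
  obtain ⟨K, -, hK⟩ := L.toLinearMap.exists_antilipschitzWith (LinearMap.ker_eq_bot.2 hL)
  have h1 := (f.compAffine L hK ((centralPhaseCoords n).symm (s, η))).integrable
    (μ := (volume : Measure (Phase n)))
  refine h1.congr (Filter.Eventually.of_forall fun ξ => ?_)
  simp only [SchwartzMap.compAffine_apply]
  congr 1
  apply (centralPhaseCoords n).injective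
  rw [map_add]
  simp [L, centralPhaseCoords_apply, add_comm]

/-- Constant in the central variable, this Gaussian is not Schwartz on `ℝ × ℝ²ⁿ`; temperate growth
is enough to multiply Schwartz functions by it. -/
theorem hasTemperateGrowth_coherentGaussian {h c : ℝ} (hh : 0 < h) (hc : 0 < c) :
    (fun v : CentralPhase n => (coherentGaussian h c v.snd.ofLp : ℂ)).HasTemperateGrowth := by
  have hp := Real.pi_pos
  let A : CentralPhase n →L[ℝ] RSpace n := (ContinuousLinearMap.fst ℝ (RSpace n) (RSpace n)).comp
    ((ContinuousLinearMap.snd ℝ ℝ (Phase n)).comp (centralPhaseCoords n).toContinuousLinearMap)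
  let B : CentralPhase n →L[ℝ] RSpace n := (ContinuousLinearMap.snd ℝ (RSpace n) (RSpace n)).comp
    ((ContinuousLinearMap.snd ℝ ℝ (Phase n)).comp (centralPhaseCoords n).toContinuousLinearMap)
  have hA : (fun v => ‖A v‖ ^ 2).HasTemperateGrowth :=
    (Function.hasTemperateGrowth_norm_sq (H := RSpace n)).comp A.hasTemperateGrowth
  have hB : (fun v => ‖B v‖ ^ 2).HasTemperateGrowth :=
    (Function.hasTemperateGrowth_norm_sq (H := RSpace n)).comp B.hasTemperateGrowth
  have hQ : (fun v => Real.pi * h / 2 * (c * ‖A v‖ ^ 2 + c⁻¹ * ‖B v‖ ^ 2)).HasTemperateGrowth := by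
    fun_prop
  have h1 := Function.Complex.hasTemperateGrowth_ofReal.comp (hQ.exp_neg fun v => by positivity)
  have h2 : (fun v : CentralPhase n => (coherentGaussian h c v.snd.ofLp : ℂ)) = Complex.ofReal ∘
      fun v => Real.exp (-(Real.pi * h / 2 * (c * ‖A v‖ ^ 2 + c⁻¹ * ‖B v‖ ^ 2))) := by
    funext v
    simp only [coherentGaussian, Function.comp_apply, ← neg_mul]
    rfl
  rw [h2]
  exact h1

open FourierTransform in
-- Fubini: the full transform is the central transform followed by the transform on `ℝ²ⁿ`.
theorem fourier_centralPhase (f : SchwartzMap (CentralPhase n) ℂ) (s : ℝ) (ξ : Phase n) :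
    𝓕 f (WithLp.toLp 2 (s, WithLp.toLp 2 ξ)) =
      phaseFourier (fun u => ∫ t : ℝ, cexp ((-(2 * Real.pi * s * t) : ℝ) * I) *
        f (WithLp.toLp 2 (t, WithLp.toLp 2 u))) ξ := by
  have hint : Integrable (fun v : CentralPhase n =>
      cexp ((-(2 * Real.pi) * ⟪v, WithLp.toLp 2 (s, WithLp.toLp 2 ξ)⟫_ℝ : ℝ) * I) * f v) := by
    refine f.integrable.bdd_mul (c := 1) ?_ (Filter.Eventually.of_forall fun g =>
      (Complex.norm_exp_ofReal_mul_I _).le)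
    exact Continuous.aestronglyMeasurable (by fun_prop)
  have hint' := ((WithLp.volume_preserving_toLp ℝ (WithLp 2 (Phase n))).integrable_comp_emb
    (MeasurableEquiv.toLp 2 (ℝ × WithLp 2 (Phase n))).measurableEmbedding).2 hint
  rw [SchwartzMap.fourier_coe, Real.fourier_eq',
    ← (WithLp.volume_preserving_toLp ℝ (WithLp 2 (Phase n))).integral_comp
    (MeasurableEquiv.toLp 2 (ℝ × WithLp 2 (Phase n))).measurableEmbedding]
  have h1 := integral_prod_symm _ hint'
  simp only [smul_eq_mul] at h1 ⊢
  refine Eq.trans ?_ (h1.trans ?_)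
  · refine integral_congr_ae (Filter.Eventually.of_forall fun p => ?_)
    simp
  rw [phaseFourier, ← (WithLp.volume_preserving_toLp (RSpace n) (RSpace n)).integral_comp
    (MeasurableEquiv.toLp 2 (Phase n)).measurableEmbedding]
  refine integral_congr_ae (Filter.Eventually.of_forall fun u => ?_)
  simp only
  rw [← integral_const_mul]
  refine integral_congr_ae (Filter.Eventually.of_forall fun t => ?_)
  simp only [Function.comp_apply, WithLp.prod_inner_apply]
  rw [← mul_assoc, ← Complex.exp_add, ← add_mul, ← ofReal_add]
  congr 4
  simp
  ring

open FourierTransform in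
-- The twist `e^{πihω(z,u)}` is a character in `u`, so it only translates the frequency, by
-- `sympFreq (h / 2) z`. What remains is the full Fourier transform of the Schwartz function `G(u)
-- φ(t, z+u)`, restricted to central frequency `h`.
theorem integrable_phaseFourier_of_schwartz {h c : ℝ} (hh : 0 < h) (hc : 0 < c)
    (φ : SchwartzMap (ℝ × Phase n) ℂ) (z : Phase n) :
    Integrable (phaseFourier (twistedGaussian h c
      (centralFourier h fun g => φ (g.s, g.x, g.y)) z)) := by
  have hanti : AntilipschitzWith _ (centralPhaseCoords n).toContinuousLinearMap :=
    (centralPhaseCoords n).antilipschitz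
  have hG := hasTemperateGrowth_coherentGaussian (n := n) hh hc
  set Φ : SchwartzMap (CentralPhase n) ℂ := SchwartzMap.smulLeftCLM ℂ
    (fun v : CentralPhase n => (coherentGaussian h c v.snd.ofLp : ℂ))
    (φ.compAffine (centralPhaseCoords n).toContinuousLinearMap hanti (0, z)) with hΦ
  have hΦa : ∀ (t : ℝ) (u : Phase n), Φ (WithLp.toLp 2 (t, WithLp.toLp 2 u)) =
      coherentGaussian h c u * φ (t, z + u) := by
    intro t u
    rw [hΦ, SchwartzMap.smulLeftCLM_apply_apply hG, SchwartzMap.compAffine_apply]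
    simp [centralPhaseCoords_apply]
  refine (integrable_slice (𝓕 Φ) h (sympFreq (h / 2) z)).congr
    (Filter.Eventually.of_forall fun ξ => ?_)
  simp only
  rw [fourier_centralPhase, phaseFourier, phaseFourier]
  refine integral_congr_ae (Filter.Eventually.of_forall fun u => ?_)
  simp only [hΦa, twistedGaussian, centralFourier]
  have h1 : ∫ t : ℝ, cexp ((-(2 * Real.pi * h * t) : ℝ) * I) *
      (coherentGaussian h c u * φ (t, z + u)) = coherentGaussian h c u *
      ∫ t : ℝ, cexp ((-(2 * Real.pi * h * t) : ℝ) * I) * φ (t, z + u) := by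
    rw [← integral_const_mul]
    congr 1
    funext t
    ring
  have h2 : cexp ((-(2 * Real.pi) * (⟪u.1, (ξ + sympFreq (h / 2) z).1⟫_ℝ +
      ⟪u.2, (ξ + sympFreq (h / 2) z).2⟫_ℝ) : ℝ) * I) =
      cexp ((-(2 * Real.pi) * (⟪u.1, ξ.1⟫_ℝ + ⟪u.2, ξ.2⟫_ℝ) : ℝ) * I) *
        cexp ((Real.pi * h * sympForm z u : ℝ) * I) := by
    rw [← Complex.exp_add, ← add_mul, ← ofReal_add]
    congr 3
    have h3 := inner_sympFreq (h / 2) z u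
    rw [Prod.fst_add, Prod.snd_add, inner_add_right, inner_add_right]
    linear_combination (-(2 * Real.pi)) * h3
  rw [h1, h2]
  simp only [Prod.mk.eta]
  ring

theorem integrable_heisenberg_of_schwartz (φ : SchwartzMap (ℝ × Phase n) ℂ) :
    Integrable fun g : Heisenberg n => φ (g.s, g.x, g.y) := by
  have : (volume : Measure (ℝ × Phase n)).IsAddHaarMeasure :=
    Measure.prod.instIsAddHaarMeasure _ _
  exact Heisenberg.integrable_iff_comp_coords_symm.2 φ.integrable

end Schwartz

end

theorem mainTheorem4 (n : ℕ) {h c κ : ℝ} (hh : 0 < h) (hc : 0 < c) (hκ : 0 < κ) :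
    (∀ (k : Heisenberg n → ℂ) (hk : Integrable k),
      (∀ᵐ z : Phase n, HasCoherentTrace hh hc (shiftOperator (repKernel h c κ k hk) z)) →
      ∃ ha : Integrable (reducedWavelet hh hc (repKernel h c κ k hk)),
        inverseWavelet h c (reducedWavelet hh hc (repKernel h c κ k hk)) ha =
          repKernel h c κ k hk) ∧
    (∀ φ : SchwartzMap (ℝ × RSpace n × RSpace n) ℂ,
      ∃ hk : Integrable fun g : Heisenberg n => φ (g.s, g.x, g.y),
        ∀ z : Phase n, HasCoherentTrace hh hc
          (shiftOperator (repKernel h c κ (fun g => φ (g.s, g.x, g.y)) hk) z)) :=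
  ⟨fun _ hk htr => inverseWavelet_reducedWavelet hh hc hκ hk htr,
    fun φ => ⟨integrable_heisenberg_of_schwartz φ, fun z =>
      (hasCoherentTrace_iff hh hc hκ _ z).2 (integrable_phaseFourier_of_schwartz hh hc φ z)⟩⟩
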